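/- Let $d\ge 2$, $n\ge 1$ and let $A_1,\dots,A_n\in\mathbb R^{d\times d}$ be independent random matrices (not necessarily symmetric or identically distributed) such that, for a symmetric positive semidefinite matrix $\Sigma$ and real numbers $\mathcal M,\mathcal V$, for every $i$: $\mathbb E[A_i]=\Sigma$; $\|A_i-\Sigma\|_2\le\mathcal M$ almost surely; and $$\max\left\{\left\|\mathbb E[(A_i-\Sigma)(A_i-\Sigma)^\top]\right\|_2,\ \left\|\mathbb E[(A_i-\Sigma)^\top(A_i-\Sigma)]\right\|_2\right\}\le\mathcal V ,$$ where $\|\cdot\|_2$ is the spectral norm. Let $v_1,\dots,v_d$ be an orthonormal basis of eigenvectors of $\Sigma$ with corresponding eigenvalues $\lambda_1\ge\lambda_2\ge\dots\ge\lambda_d$, and assume $\mathrm{gap}:=\lambda_1-\lambda_2>0$. Put $$\beta=720\max\left(\frac{\mathcal M}{\mathrm{gap}},\ \frac{\mathcal V+\lambda_1^2}{\mathrm{gap}^2}\right),\qquad \eta_i=\frac{6}{\mathrm{gap}\,(\beta+i)}\quad(1\le i\le n).$$ Oja's algorithm draws $w_0$ uniformly at random from the unit sphere of $\mathbb R^d$,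 independently of $(A_1,\dots,A_n)$, and for $i=1,\dots,n$ sets $$w_i=\frac{w_{i-1}+\eta_iA_iw_{i-1}}{\|w_{i-1}+\eta_iA_iw_{i-1}\|_2}.$$ There is an absolute constant $C>0$ (independent of all the data above) such that, whenever $n>\beta^{1.2}d^{0.1}$, with probability greater than $3/4$ the output $w_n$ is a unit vector satisfying $$\sin^2(w_n,v_1):=1-(w_n^\top v_1)^2\ \le\ C\left(\frac{\mathcal V}{\mathrm{gap}^2}\cdot\frac1n+\frac1{n^2}\right).$$ -/

import Mathlib

open MeasureTheory ProbabilityTheory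
open scoped Matrix ENNReal Matrix.Norms.L2Operator

/-! The norm `‖·‖` on matrices is the spectral norm (operator norm for the Euclidean norm), by the
scoped instances `Matrix.Norms.L2Operator`. -/

noncomputable section

namespace StreamingPCA

/-- The product (equivalently, Borel) σ-algebra on real matrices: measurability is entrywise. -/
instance instMeasurableSpaceMatrix {d : ℕ} : MeasurableSpace (Matrix (Fin d) (Fin d) ℝ) :=
  inferInstanceAs (MeasurableSpace (Fin d → Fin d → ℝ))

/-- Entrywise expectation of a random matrix. -/
def matExp {Ω : Type*} [MeasurableSpace Ω] (P : Measure Ω) {d : ℕ}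
    (X : Ω → Matrix (Fin d) (Fin d) ℝ) : Matrix (Fin d) (Fin d) ℝ :=
  Matrix.of fun j k => ∫ ω, X ω j k ∂P

/-- The streaming PCA model: `A 0, …, A (n - 1)` (the samples `A₁, …, Aₙ`) are independent random
real `d × d` matrices, not necessarily symmetric and not necessarily identically distributed, with
common mean `S` (positive semidefinite), almost sure deviation at most `M` in spectral norm, and
variance parameter at most `V`. -/
structure Model {Ω : Type*} [MeasurableSpace Ω] (P : Measure Ω) {d n : ℕ}
    (A : Fin n → Ω → Matrix (Fin d) (Fin d) ℝ) (S : Matrix (Fin d) (Fin d) ℝ) (M V : ℝ) :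
    Prop where
  measurable : ∀ i, Measurable (A i)
  indep : iIndepFun A P
  posSemidef : S.PosSemidef
  mean : ∀ i, matExp P (A i) = S
  bounded : ∀ i, ∀ᵐ ω ∂P, ‖A i ω - S‖ ≤ M
  variance : ∀ i,
    max ‖matExp P (fun ω => (A i ω - S) * (A i ω - S)ᵀ)‖
      ‖matExp P (fun ω => (A i ω - S)ᵀ * (A i ω - S))‖ ≤ V

/-- `v` is an orthonormal basis of eigenvectors of `S`, with corresponding eigenvalues `lam` listed
in non-increasing order. -/
structure IsEigenDecomp {d : ℕ} (S : Matrix (Fin d) (Fin d) ℝ)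
    (v : OrthonormalBasis (Fin d) ℝ (EuclideanSpace ℝ (Fin d))) (lam : Fin d → ℝ) : Prop where
  antitone : Antitone lam
  eigen : ∀ i, Matrix.toEuclideanLin S (v i) = lam i • v i

/-- The uniform probability measure on the unit sphere of `ℝᵈ`, as a measure on `ℝᵈ`: normalized
surface measure. -/
def uniformSphere (d : ℕ) : Measure (EuclideanSpace ℝ (Fin d)) :=
  (((volume : Measure (EuclideanSpace ℝ (Fin d))).toSphere Set.univ)⁻¹ •
    (volume : Measure (EuclideanSpace ℝ (Fin d))).toSphere).map Subtype.val

/-- One step of Oja's algorithm: `w ← w + η A w`, then `w ← w / ‖w‖`. -/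
def ojaStep {d : ℕ} (η : ℝ) (A : Matrix (Fin d) (Fin d) ℝ) (w : EuclideanSpace ℝ (Fin d)) :
    EuclideanSpace ℝ (Fin d) :=
  ‖w + η • Matrix.toEuclideanLin A w‖⁻¹ • (w + η • Matrix.toEuclideanLin A w)

/-- The output `wₙ` of Oja's algorithm on the input matrices `A 0, …, A (n - 1)` (that is,
`A₁, …, Aₙ`) with step sizes `η 1, …, η n` and initial vector `w₀`. -/
def oja {d : ℕ} (η : ℕ → ℝ) (w₀ : EuclideanSpace ℝ (Fin d)) :
    (n : ℕ) → (Fin n → Matrix (Fin d) (Fin d) ℝ) → EuclideanSpace ℝ (Fin d)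
  | 0, _ => w₀
  | n + 1, A => ojaStep (η (n + 1)) (A (Fin.last n)) (oja η w₀ n fun i => A i.castSucc)

/-- `sin²(w, v) = 1 - (wᵀ v)²`, for unit vectors. -/
def sinSq {d : ℕ} (w v : EuclideanSpace ℝ (Fin d)) : ℝ :=
  1 - (inner ℝ w v) ^ 2

/-- `w` is an `ε`-approximation to `v`: a unit vector with `sin²(w, v) ≤ ε`. -/
def IsApprox {d : ℕ} (ε : ℝ) (w v : EuclideanSpace ℝ (Fin d)) : Prop :=
  ‖w‖ = 1 ∧ sinSq w v ≤ ε

/-- The parameter `β = 720 max (M / gap, (V + λ₁²) / gap²)`. -/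
def stepOffset (M V lam1 gap : ℝ) : ℝ :=
  720 * max (M / gap) ((V + lam1 ^ 2) / gap ^ 2)

/-- The step sizes `ηᵢ = 6 / (gap (β + i))`. -/
def stepSize (gap β : ℝ) (i : ℕ) : ℝ :=
  6 / (gap * (β + i))

end StreamingPCA

end

namespace StreamingPCA

/-! ### The uniform distribution on the sphere -/

section Sphere

variable {d : ℕ}

/-! Normalisation commutes with the linear steps, so `w_n` is the direction of `u = B w₀`, where `B`
is the product of the factors `1 + ηᵢ Aᵢ`. With `e` the top eigenvector, the error is `‖perp e u‖² /
‖u‖² ≤ ‖perp e u‖² / ⟨e, u⟩²`, and the two quantities are controlled separately by second moments.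

Denominator: `⟨e, u⟩ = ⟨q, w₀⟩` with `q = Bᵀ e` independent of `w₀`. A uniform unit vector rarely
has `|⟨q, w₀⟩|` below `‖q‖ / (64 √d)` (`uniformSphere_abs_inner_lt_le`), and `‖q‖ ≥ ⟨e, B e⟩`. The
latter has mean `m = ∏ (1 + ηᵢ λ₁)` and variance at most `m² / 16`, so Chebyshev bounds it below by
`m / 5`. Hence `⟨e, u⟩²` is at least of order `m² / d`.

Numerator: averaged over `w₀`, the noise leaking from `e` into its complement is proportional to `E
⟨e, u⟩² = E ‖Bᵀ e‖² / d`; this `1 / d` cancels the `d` lost in the denominator. The resulting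
recursion `perpBound` contracts relative to `m²` by about `(t / (t + 1))^12` at time `t = β + i`,
because `ηᵢ gap = 6 / t`. The initial mass thus decays like `d (β / n)^12`, which is at most `1 /
n²` when `n^10 ≥ β^12 d`, and the accumulated noise is of order `V / (gap² n)` (`perpBound_mul_le`,
`perpBound_le`). Markov's inequality and a union bound conclude. -/

open scoped Pointwise in
lemma uniformSphere_apply (hd : 0 < d) {s : Set (EuclideanSpace ℝ (Fin d))}
    (hs : MeasurableSet s) :
    uniformSphere d s = (volume (Metric.ball (0 : EuclideanSpace ℝ (Fin d)) 1))⁻¹ *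
      volume {x : EuclideanSpace ℝ (Fin d) |
        x ∈ Metric.ball (0 : EuclideanSpace ℝ (Fin d)) 1 ∧ x ≠ 0 ∧ ‖x‖⁻¹ • x ∈ s} := by
  have hdim : Module.finrank ℝ (EuclideanSpace ℝ (Fin d)) = d := by simp
  -- `toSphere` is `d` times the volume of the cone over a set; the factor `d` cancels in the
  -- normalisation.
  have hset : Set.Ioo (0 : ℝ) 1 • ((↑) '' (Subtype.val ⁻¹' s :
        Set (Metric.sphere (0 : EuclideanSpace ℝ (Fin d)) 1)) : Set (EuclideanSpace ℝ (Fin d))) =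
      {x : EuclideanSpace ℝ (Fin d) |
        x ∈ Metric.ball (0 : EuclideanSpace ℝ (Fin d)) 1 ∧ x ≠ 0 ∧ ‖x‖⁻¹ • x ∈ s} := by
    ext x
    simp only [Set.mem_smul, Set.mem_image, Set.mem_preimage, Set.mem_ofPred_eq, Set.mem_Ioo,
      mem_ball_zero_iff]
    constructor
    · rintro ⟨r, ⟨hr0, hr1⟩, y, ⟨z, hz, rfl⟩, rfl⟩
      have hzn : ‖(z : EuclideanSpace ℝ (Fin d))‖ = 1 := by simp
      have hn : ‖r • (z : EuclideanSpace ℝ (Fin d))‖ = r := by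
        rw [norm_smul, hzn, Real.norm_of_nonneg hr0.le, mul_one]
      refine ⟨by rwa [hn], fun h => ?_, ?_⟩
      · rw [h, norm_zero] at hn
        exact hr0.ne hn
      · rwa [hn, smul_smul, inv_mul_cancel₀ hr0.ne', one_smul]
    · rintro ⟨h1, h0, hx⟩
      have hpos : 0 < ‖x‖ := norm_pos_iff.2 h0
      refine ⟨‖x‖, ⟨hpos, h1⟩, ‖x‖⁻¹ • x, ⟨⟨‖x‖⁻¹ • x, ?_⟩, hx, rfl⟩, ?_⟩
      · rw [mem_sphere_zero_iff_norm, norm_smul, norm_inv, norm_norm, inv_mul_cancel₀ hpos.ne']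
      · rw [smul_smul, mul_inv_cancel₀ hpos.ne', one_smul]
  have hd0 : (d : ℝ≥0∞) ≠ 0 := by exact_mod_cast hd.ne'
  rw [uniformSphere, Measure.map_apply measurable_subtype_coe hs, Measure.smul_apply,
    Measure.toSphere_apply' _ (measurable_subtype_coe hs), Measure.toSphere_apply_univ, hset, hdim,
    smul_eq_mul, ENNReal.mul_inv (Or.inl hd0) (Or.inl (ENNReal.natCast_ne_top d)), mul_comm (d : ℝ≥0∞)⁻¹,
    mul_assoc, ← mul_assoc (d : ℝ≥0∞)⁻¹, ENNReal.inv_mul_cancel hd0 (ENNReal.natCast_ne_top d),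
    one_mul]

lemma ae_uniformSphere_norm : ∀ᵐ w ∂uniformSphere d, ‖w‖ = 1 := by
  have hm : MeasurableSet {w : EuclideanSpace ℝ (Fin d) | ‖w‖ = 1} :=
    measurableSet_eq_fun measurable_norm measurable_const
  rw [uniformSphere, ae_map_iff measurable_subtype_coe.aemeasurable hm]
  exact Filter.Eventually.of_forall fun x => by simp

lemma isProbabilityMeasure_uniformSphere (hd : 0 < d) :
    IsProbabilityMeasure (uniformSphere d) := by
  have : Nonempty (Fin d) := ⟨⟨0, hd⟩⟩
  have h0 : (volume : Measure (EuclideanSpace ℝ (Fin d))).toSphere Set.univ ≠ 0 := by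
    rw [Measure.measure_univ_ne_zero]
    exact Measure.toSphere_ne_zero _
  refine ⟨?_⟩
  rw [uniformSphere, Measure.map_apply measurable_subtype_coe MeasurableSet.univ, Set.preimage_univ,
    Measure.smul_apply, smul_eq_mul, ENNReal.inv_mul_cancel h0 (measure_ne_top _ _)]

lemma map_uniformSphere (hd : 0 < d)
    (R : EuclideanSpace ℝ (Fin d) ≃ₗᵢ[ℝ] EuclideanSpace ℝ (Fin d)) :
    (uniformSphere d).map R = uniformSphere d := by
  have hR : Measurable R := R.continuous.measurable
  ext s hs
  rw [Measure.map_apply hR hs, uniformSphere_apply hd hs, uniformSphere_apply hd (hR hs),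
    ← MeasurePreserving.measure_preimage_equiv (f := R.toMeasurableEquiv) R.measurePreserving
      {x | x ∈ _ ∧ x ≠ 0 ∧ ‖x‖⁻¹ • x ∈ s}]
  congr 2
  ext x
  simp

/-- By invariance under reflections the integral depends only on `‖q‖`. Over an orthonormal basis
scaled by `‖q‖` the `d` equal integrals add up to `‖q‖²`. -/
lemma lintegral_uniformSphere_inner_sq (hd : 0 < d) (q : EuclideanSpace ℝ (Fin d)) :
    ∫⁻ w, ENNReal.ofReal (inner ℝ q w ^ 2) ∂uniformSphere d = ENNReal.ofReal (‖q‖ ^ 2 / d) := by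
  have := isProbabilityMeasure_uniformSphere hd
  set F : EuclideanSpace ℝ (Fin d) → ℝ≥0∞ :=
    fun q => ∫⁻ w, ENNReal.ofReal (inner ℝ q w ^ 2) ∂uniformSphere d with hF
  have hmeas : ∀ q : EuclideanSpace ℝ (Fin d),
      Measurable fun w : EuclideanSpace ℝ (Fin d) => ENNReal.ofReal (inner ℝ q w ^ 2) := by
    intro q
    fun_prop
  have hrot : ∀ p q : EuclideanSpace ℝ (Fin d), ‖p‖ = ‖q‖ → F p = F q := by
    intro p q hpq
    let R := (ℝ ∙ (p - q))ᗮ.reflection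
    have hR : R p = q := Submodule.reflection_sub hpq
    rw [hF]
    dsimp only
    rw [← map_uniformSphere hd R, lintegral_map (hmeas q) R.continuous.measurable,
      map_uniformSphere hd R, ← hR]
    simp
  have hsum : ∀ c : ℝ, ∑ i : Fin d, F (c • EuclideanSpace.basisFun (Fin d) ℝ i) =
      ENNReal.ofReal (c ^ 2) := by
    intro c
    rw [hF, ← lintegral_finsetSum _ fun i _ => hmeas _]
    have : (fun w : EuclideanSpace ℝ (Fin d) => ∑ i : Fin d,
        ENNReal.ofReal (inner ℝ (c • EuclideanSpace.basisFun (Fin d) ℝ i) w ^ 2)) =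
        fun w => ENNReal.ofReal (c ^ 2 * ‖w‖ ^ 2) := by
      ext w
      rw [← ENNReal.ofReal_sum_of_nonneg fun i _ => sq_nonneg _,
        ← (EuclideanSpace.basisFun (Fin d) ℝ).sum_sq_norm_inner_right w, Finset.mul_sum]
      simp [inner_smul_left, mul_pow]
    rw [this]
    have h1 : ∀ᵐ w ∂uniformSphere d, ENNReal.ofReal (c ^ 2 * ‖w‖ ^ 2) = ENNReal.ofReal (c ^ 2) := by
      filter_upwards [ae_uniformSphere_norm] with w hw
      simp [hw]
    rw [lintegral_congr_ae h1]
    simp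
  have hconst : ∀ i, F (‖q‖ • EuclideanSpace.basisFun (Fin d) ℝ i) = F q := fun i =>
    hrot _ _ (by simp [norm_smul])
  have h := hsum ‖q‖
  simp only [hconst, Finset.sum_const, Finset.card_univ, Fintype.card_fin, nsmul_eq_mul] at h
  have hd0 : (d : ℝ≥0∞) ≠ 0 := by exact_mod_cast hd.ne'
  change F q = _
  rw [ENNReal.ofReal_div_of_pos (by exact_mod_cast hd), ENNReal.ofReal_natCast,
    ENNReal.eq_div_iff hd0 (ENNReal.natCast_ne_top d), h]

end Sphere

/-! ### Anti-concentration of the uniform distribution near an equator -/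

section Slab

variable {d : ℕ}

lemma sqrt_one_add_inv_pow_le_two (hd : 0 < d) : √(1 + 1 / (d : ℝ)) ^ d ≤ 2 := by
  have hd' : (0 : ℝ) < d := by exact_mod_cast hd
  have h0 : (0 : ℝ) ≤ 1 + 1 / d := by positivity
  have h1 : (1 + 1 / (d : ℝ)) ^ d ≤ 4 := by
    calc (1 + 1 / (d : ℝ)) ^ d ≤ Real.exp (1 / d) ^ d := by
          gcongr
          linarith [Real.add_one_le_exp (1 / (d : ℝ))]
      _ = Real.exp 1 := by
          rw [← Real.exp_nat_mul, mul_one_div_cancel hd'.ne']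
      _ ≤ 4 := by linarith [Real.exp_one_lt_d9]
  have h2 : (√(1 + 1 / (d : ℝ)) ^ d) ^ 2 ≤ 2 ^ 2 := by
    rw [← pow_mul, mul_comm, pow_mul, Real.sq_sqrt h0]
    linarith
  exact le_of_sq_le_sq h2 (by norm_num)

/-- A thin slab around the centre fills a small part of the unit ball: many disjoint translates of
it fit into a slightly larger ball. -/
lemma volume_slab_le (hd : 0 < d) {e : EuclideanSpace ℝ (Fin d)} (he : ‖e‖ = 1) :
    volume {x : EuclideanSpace ℝ (Fin d) | ‖x‖ < 1 ∧ |inner ℝ e x| < 1 / (64 * √d)} ≤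
      1 / 16 * volume (Metric.ball (0 : EuclideanSpace ℝ (Fin d)) 1) := by
  have hd' : (0 : ℝ) < d := by exact_mod_cast hd
  have hsq : √(d : ℝ) ^ 2 = d := Real.sq_sqrt hd'.le
  -- The half-width is chosen so that 32 translates, at spacing `2 s`, only raise the squared radius
  -- to `1 + 4096 s² = 1 + 1 / d`, which costs a bounded factor in volume.
  set s : ℝ := 1 / (64 * √d) with hs
  have hspos : 0 < s := by positivity
  have hs2 : 4096 * s ^ 2 = 1 / d := by
    rw [hs, div_pow, mul_pow, hsq]
    field_simp
    norm_num
  set S : Set (EuclideanSpace ℝ (Fin d)) := {x | ‖x‖ < 1 ∧ |inner ℝ e x| < s} with hS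
  have hSm : MeasurableSet S := by
    have h : Measurable fun x : EuclideanSpace ℝ (Fin d) => |inner ℝ e x| := by fun_prop
    exact (measurableSet_lt measurable_norm measurable_const).inter
      (measurableSet_lt h measurable_const)
  let T : ℕ → Set (EuclideanSpace ℝ (Fin d)) := fun k => (· + -((2 * k * s) • e)) ⁻¹' S
  have hTm : ∀ k, MeasurableSet (T k) := fun k => hSm.preimage (measurable_add_const _)
  have hTv : ∀ k, volume (T k) = volume S := fun k => measure_preimage_add_right _ _ _
  have hin : ∀ k x, x ∈ T k → ‖x - (2 * k * s) • e‖ < 1 ∧ |inner ℝ e x - 2 * k * s| < s := by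
    intro k x hx
    have h := hx
    simpa only [T, hS, Set.mem_preimage, Set.mem_ofPred_eq, ← sub_eq_add_neg, inner_sub_right,
      inner_smul_right, real_inner_self_eq_norm_sq, he, one_pow, mul_one] using h
  have hdisj : Pairwise (Function.onFun Disjoint T) := by
    intro k l hkl
    refine Set.disjoint_left.2 fun x hk hl => hkl ?_
    have h1 := abs_lt.1 (hin k x hk).2
    have h2 := abs_lt.1 (hin l x hl).2
    have h3 : (k : ℝ) < l + 1 := by
      by_contra! h
      nlinarith
    have h4 : (l : ℝ) < k + 1 := by
      by_contra! h
      nlinarith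
    have h3' : k < l + 1 := by exact_mod_cast h3
    have h4' : l < k + 1 := by exact_mod_cast h4
    omega
  have hsub : (⋃ k ∈ Finset.range 32, T k) ⊆
      Metric.ball (0 : EuclideanSpace ℝ (Fin d)) (√(1 + 1 / d)) := by
    intro x hx
    simp only [Set.mem_iUnion, Finset.mem_range] at hx
    obtain ⟨k, hk, hx⟩ := hx
    have h := hin k x hx
    have hk' : (k : ℝ) ≤ 31 := by exact_mod_cast Nat.lt_succ_iff.1 hk
    have hk0 : (0 : ℝ) ≤ k := Nat.cast_nonneg k
    have h1 := (abs_lt.1 h.2).2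
    have h2 : ‖x - (2 * k * s) • e‖ ^ 2 < 1 := by
      rw [sq_lt_one_iff₀ (norm_nonneg _)]
      exact h.1
    rw [norm_sub_sq_real, inner_smul_right, norm_smul, he, mul_one, Real.norm_of_nonneg (by positivity),
      real_inner_comm] at h2
    rw [mem_ball_zero_iff]
    refine Real.lt_sqrt_of_sq_lt ?_
    -- Expanding the square gives `‖x‖² < 1 + 4 k s ⟨e, x⟩ - 4 k² s²`; with `⟨e, x⟩ < (2 k + 1) s`
    -- the excess is at most `(4 k² + 4 k) s²`, and `k ≤ 31`.
    have h3 : (k : ℝ) * s * inner ℝ e x ≤ k * s * (2 * k * s + s) := by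
      apply mul_le_mul_of_nonneg_left (by linarith) (by positivity)
    have h4 : (4 * k * k + 4 * k) * s ^ 2 ≤ 4096 * s ^ 2 := by
      apply mul_le_mul_of_nonneg_right _ (sq_nonneg s)
      nlinarith
    nlinarith
  have hsum : 32 * volume S ≤
      2 * volume (Metric.ball (0 : EuclideanSpace ℝ (Fin d)) 1) := by
    calc 32 * volume S = ∑ k ∈ Finset.range 32, volume (T k) := by
          simp [hTv]
      _ = volume (⋃ k ∈ Finset.range 32, T k) :=
          (measure_biUnion_finset (fun k _ l _ h => hdisj h) fun k _ => hTm k).symm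
      _ ≤ volume (Metric.ball (0 : EuclideanSpace ℝ (Fin d)) (√(1 + 1 / d))) := measure_mono hsub
      _ = ENNReal.ofReal (√(1 + 1 / (d : ℝ)) ^ d) *
            volume (Metric.ball (0 : EuclideanSpace ℝ (Fin d)) 1) := by
          rw [Measure.addHaar_ball_of_pos _ _ (by positivity)]
          simp
      _ ≤ 2 * volume (Metric.ball (0 : EuclideanSpace ℝ (Fin d)) 1) := by
          gcongr
          rw [← ENNReal.ofReal_ofNat]
          exact ENNReal.ofReal_le_ofReal (sqrt_one_add_inv_pow_le_two hd)
  calc volume S = 1 / 32 * (32 * volume S) := by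
        rw [← mul_assoc, one_div, ENNReal.inv_mul_cancel (by norm_num) (by norm_num), one_mul]
    _ ≤ 1 / 32 * (2 * volume (Metric.ball (0 : EuclideanSpace ℝ (Fin d)) 1)) := by gcongr
    _ = 1 / 16 * volume (Metric.ball (0 : EuclideanSpace ℝ (Fin d)) 1) := by
        rw [← mul_assoc]
        congr 1
        rw [← ENNReal.toReal_eq_toReal_iff' (by finiteness) (by finiteness)]
        norm_num

/-- The inner product scales with `‖x‖ < 1`, so the cone over the thin band lies inside the slab. -/
lemma uniformSphere_abs_inner_lt_le (hd : 0 < d) (q : EuclideanSpace ℝ (Fin d)) :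
    uniformSphere d {w | |inner ℝ q w| < ‖q‖ / (64 * √d)} ≤ 1 / 16 := by
  rcases eq_or_ne q 0 with rfl | hq
  · simp
  have hq' : 0 < ‖q‖ := norm_pos_iff.2 hq
  have hm : MeasurableSet {w : EuclideanSpace ℝ (Fin d) | |inner ℝ q w| < ‖q‖ / (64 * √d)} := by
    refine measurableSet_lt ?_ measurable_const
    fun_prop
  have he : ‖‖q‖⁻¹ • q‖ = 1 := by
    rw [norm_smul, norm_inv, norm_norm, inv_mul_cancel₀ hq'.ne']
  have hB0 : volume (Metric.ball (0 : EuclideanSpace ℝ (Fin d)) 1) ≠ 0 :=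
    (Metric.measure_ball_pos _ _ one_pos).ne'
  have hB1 : volume (Metric.ball (0 : EuclideanSpace ℝ (Fin d)) 1) ≠ ∞ := measure_ball_lt_top.ne
  rw [uniformSphere_apply hd hm]
  calc _ ≤ (volume (Metric.ball (0 : EuclideanSpace ℝ (Fin d)) 1))⁻¹ *
        (1 / 16 * volume (Metric.ball (0 : EuclideanSpace ℝ (Fin d)) 1)) := by
        gcongr
        refine (measure_mono ?_).trans (volume_slab_le hd he)
        rintro x ⟨hx1, hx0, hx⟩
        rw [mem_ball_zero_iff] at hx1
        refine ⟨hx1, ?_⟩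
        have hxpos : 0 < ‖x‖ := norm_pos_iff.2 hx0
        rw [Set.mem_ofPred_eq, inner_smul_right, abs_mul, abs_of_pos (inv_pos.2 hxpos),
          inv_mul_lt_iff₀ hxpos] at hx
        rw [real_inner_smul_left, abs_mul, abs_of_pos (inv_pos.2 hq'), inv_mul_lt_iff₀ hq',
          mul_one_div]
        refine hx.trans_le (mul_le_of_le_one_left (by positivity) hx1.le)
    _ = 1 / 16 := by
        rw [mul_left_comm, ENNReal.inv_mul_cancel hB0 hB1, mul_one]

end Slab

/-! ### Matrices acting on Euclidean space -/

section MatrixLemmas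

variable {d : ℕ}

instance instBorelSpaceMatrix : BorelSpace (Matrix (Fin d) (Fin d) ℝ) :=
  inferInstanceAs (BorelSpace (Fin d → Fin d → ℝ))

instance instSecondCountableMatrix : SecondCountableTopology (Matrix (Fin d) (Fin d) ℝ) :=
  inferInstanceAs (SecondCountableTopology (Fin d → Fin d → ℝ))

lemma measurable_matrix_entry (j k : Fin d) :
    Measurable fun X : Matrix (Fin d) (Fin d) ℝ => X j k :=
  (measurable_pi_apply k).comp (measurable_pi_apply (X := fun _ : Fin d => Fin d → ℝ) j)

lemma measurable_transpose : Measurable fun X : Matrix (Fin d) (Fin d) ℝ => Xᵀ :=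
  (Continuous.matrix_transpose continuous_id).measurable

lemma norm_toEuclideanLin_le (X : Matrix (Fin d) (Fin d) ℝ) (x : EuclideanSpace ℝ (Fin d)) :
    ‖Matrix.toEuclideanLin X x‖ ≤ ‖X‖ * ‖x‖ :=
  Matrix.l2_opNorm_mulVec X x

lemma inner_toEuclideanLin (X : Matrix (Fin d) (Fin d) ℝ) (p q : EuclideanSpace ℝ (Fin d)) :
    inner ℝ p (Matrix.toEuclideanLin X q) = ∑ j, ∑ k, p j * q k * X j k := by
  simp only [PiLp.inner_apply, Matrix.toLpLin_apply, Matrix.mulVec, dotProduct, RCLike.inner_apply,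
    conj_trivial, Finset.sum_mul]
  refine Finset.sum_congr rfl fun j _ => Finset.sum_congr rfl fun k _ => by ring

lemma inner_toEuclideanLin_transpose (X : Matrix (Fin d) (Fin d) ℝ)
    (p q : EuclideanSpace ℝ (Fin d)) :
    inner ℝ p (Matrix.toEuclideanLin X q) = inner ℝ (Matrix.toEuclideanLin Xᵀ p) q := by
  rw [real_inner_comm q, inner_toEuclideanLin, inner_toEuclideanLin, Finset.sum_comm]
  refine Finset.sum_congr rfl fun j _ => Finset.sum_congr rfl fun k _ => ?_
  rw [Matrix.transpose_apply]
  ring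

lemma toEuclideanLin_mul_apply (X Y : Matrix (Fin d) (Fin d) ℝ) (q : EuclideanSpace ℝ (Fin d)) :
    Matrix.toEuclideanLin (X * Y) q = Matrix.toEuclideanLin X (Matrix.toEuclideanLin Y q) := by
  simp [Matrix.toLpLin_apply]

lemma norm_transpose (X : Matrix (Fin d) (Fin d) ℝ) : ‖Xᵀ‖ = ‖X‖ := by
  rw [← Matrix.conjTranspose_eq_transpose_of_trivial, Matrix.l2_opNorm_conjTranspose]

lemma abs_entry_le_norm (X : Matrix (Fin d) (Fin d) ℝ) (j k : Fin d) : |X j k| ≤ ‖X‖ := by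
  have h : X j k = inner ℝ (EuclideanSpace.single j (1 : ℝ))
      (Matrix.toEuclideanLin X (EuclideanSpace.single k (1 : ℝ))) := by
    rw [EuclideanSpace.inner_single_left]
    simp [Matrix.toLpLin_apply]
  rw [h]
  refine (abs_real_inner_le_norm _ _).trans ?_
  have := norm_toEuclideanLin_le X (EuclideanSpace.single k (1 : ℝ))
  simpa using this

lemma continuous_toEuclideanLin : Continuous
    fun z : Matrix (Fin d) (Fin d) ℝ × EuclideanSpace ℝ (Fin d) => Matrix.toEuclideanLin z.1 z.2 := by
  have h : Continuous fun z : Matrix (Fin d) (Fin d) ℝ × EuclideanSpace ℝ (Fin d) =>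
      z.1 *ᵥ (z.2 : Fin d → ℝ) :=
    Continuous.matrix_mulVec continuous_fst ((PiLp.continuous_ofLp 2 _).comp continuous_snd)
  exact (PiLp.continuous_toLp 2 _).comp h

end MatrixLemmas

/-! ### Moments of one random matrix -/

section OneStep

variable {Ω : Type*} [MeasurableSpace Ω] {P : Measure Ω} {d : ℕ}

lemma integrable_entry [IsProbabilityMeasure P] {X : Ω → Matrix (Fin d) (Fin d) ℝ} {M : ℝ} (hX : Measurable X)
    (hb : ∀ᵐ ω ∂P, ‖X ω‖ ≤ M) (j k : Fin d) : Integrable (fun ω => X ω j k) P := by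
  refine Integrable.of_bound ((measurable_matrix_entry j k).comp hX).aestronglyMeasurable M ?_
  filter_upwards [hb] with ω hω
  exact (abs_entry_le_norm _ j k).trans hω

lemma integrable_inner_toEuclideanLin {X : Ω → Matrix (Fin d) (Fin d) ℝ}
    (hX : ∀ j k, Integrable (fun ω => X ω j k) P) (p q : EuclideanSpace ℝ (Fin d)) :
    Integrable (fun ω => inner ℝ p (Matrix.toEuclideanLin (X ω) q)) P := by
  simp only [inner_toEuclideanLin]
  exact integrable_finsetSum _ fun j _ => integrable_finsetSum _ fun k _ => (hX j k).const_mul _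

lemma integral_inner_toEuclideanLin {X : Ω → Matrix (Fin d) (Fin d) ℝ}
    (hX : ∀ j k, Integrable (fun ω => X ω j k) P) (p q : EuclideanSpace ℝ (Fin d)) :
    ∫ ω, inner ℝ p (Matrix.toEuclideanLin (X ω) q) ∂P =
      inner ℝ p (Matrix.toEuclideanLin (matExp P X) q) := by
  simp only [inner_toEuclideanLin]
  rw [integral_finsetSum _ fun j _ => integrable_finsetSum _ fun k _ => (hX j k).const_mul _]
  refine Finset.sum_congr rfl fun j _ => ?_
  rw [integral_finsetSum _ fun k _ => (hX j k).const_mul _]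
  refine Finset.sum_congr rfl fun k _ => ?_
  rw [integral_const_mul]
  rfl

/-- Second moment of a vector perturbed by a centred random matrix. -/
lemma lintegral_norm_add_smul_sq_le [IsProbabilityMeasure P] {F : Type*} [NormedAddCommGroup F] [InnerProductSpace ℝ F]
    [CompleteSpace F] {X : Ω → Matrix (Fin d) (Fin d) ℝ} {M V : ℝ} (hX : Measurable X)
    (hmean : matExp P X = 0) (hb : ∀ᵐ ω ∂P, ‖X ω‖ ≤ M)
    (hV : ‖matExp P fun ω => (X ω)ᵀ * X ω‖ ≤ V) (T : EuclideanSpace ℝ (Fin d) →L[ℝ] F)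
    (hT : ‖T‖ ≤ 1) (p : F) (g : EuclideanSpace ℝ (Fin d)) (η : ℝ) :
    ∫⁻ ω, ENNReal.ofReal (‖p + η • T (Matrix.toEuclideanLin (X ω) g)‖ ^ 2) ∂P ≤
      ENNReal.ofReal (‖p‖ ^ 2 + η ^ 2 * V * ‖g‖ ^ 2) := by
  have hXX : Measurable fun ω => (X ω)ᵀ * X ω := by
    have h : Continuous fun Y : Matrix (Fin d) (Fin d) ℝ => Yᵀ * Y :=
      (Continuous.matrix_transpose continuous_id).matrix_mul continuous_id
    exact h.measurable.comp hX
  have hXXb : ∀ᵐ ω ∂P, ‖(X ω)ᵀ * X ω‖ ≤ M * M := by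
    filter_upwards [hb] with ω hω
    refine (Matrix.l2_opNorm_mul _ _).trans ?_
    rw [norm_transpose]
    exact mul_le_mul hω hω (norm_nonneg _) ((norm_nonneg _).trans hω)
  have hi1 := integrable_inner_toEuclideanLin (integrable_entry hX hb) (T.adjoint p) g
  have hi2 := integrable_inner_toEuclideanLin (integrable_entry hXX hXXb) g g
  -- The expanded square, with `‖T X g‖²` relaxed to `‖X g‖² = ⟨g, Xᵀ X g⟩`. In expectation the
  -- cross term vanishes and the last term is controlled by `V`; the almost sure bound serves only
  -- for integrability.
  set h : Ω → ℝ := fun ω => ‖p‖ ^ 2 +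
    2 * η * inner ℝ (T.adjoint p) (Matrix.toEuclideanLin (X ω) g) +
    η ^ 2 * inner ℝ g (Matrix.toEuclideanLin ((X ω)ᵀ * X ω) g) with hh
  have hi0 : Integrable (fun ω => ‖p‖ ^ 2 +
      2 * η * inner ℝ (T.adjoint p) (Matrix.toEuclideanLin (X ω) g)) P :=
    (integrable_const _).add (hi1.const_mul _)
  have hint : Integrable h P := hi0.add (hi2.const_mul _)
  have hle : ∀ ω, ‖p + η • T (Matrix.toEuclideanLin (X ω) g)‖ ^ 2 ≤ h ω := by
    intro ω
    have h1 : inner ℝ g (Matrix.toEuclideanLin ((X ω)ᵀ * X ω) g) =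
        ‖Matrix.toEuclideanLin (X ω) g‖ ^ 2 := by
      rw [toEuclideanLin_mul_apply, inner_toEuclideanLin_transpose, Matrix.transpose_transpose,
        real_inner_self_eq_norm_sq]
    have h2 : ‖T (Matrix.toEuclideanLin (X ω) g)‖ ≤ ‖Matrix.toEuclideanLin (X ω) g‖ :=
      (T.le_opNorm _).trans (mul_le_of_le_one_left (norm_nonneg _) hT)
    rw [hh]
    dsimp only
    rw [h1, norm_add_sq_real, inner_smul_right, norm_smul, mul_pow, Real.norm_eq_abs, sq_abs,
      ContinuousLinearMap.adjoint_inner_left, mul_assoc 2 η]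
    gcongr
  have hnn : ∀ ω, 0 ≤ h ω := fun ω => (sq_nonneg _).trans (hle ω)
  have hval : ∫ ω, h ω ∂P ≤ ‖p‖ ^ 2 + η ^ 2 * V * ‖g‖ ^ 2 := by
    rw [hh, integral_add hi0 (hi2.const_mul _),
      integral_add (integrable_const _) (hi1.const_mul _), integral_const_mul, integral_const_mul,
      integral_inner_toEuclideanLin (integrable_entry hX hb),
      integral_inner_toEuclideanLin (integrable_entry hXX hXXb), hmean]
    have h3 : inner ℝ g (Matrix.toEuclideanLin (matExp P fun ω => (X ω)ᵀ * X ω) g) ≤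
        V * ‖g‖ ^ 2 := by
      calc _ ≤ ‖g‖ * ‖Matrix.toEuclideanLin (matExp P fun ω => (X ω)ᵀ * X ω) g‖ :=
            real_inner_le_norm _ _
        _ ≤ ‖g‖ * (V * ‖g‖) := by
            gcongr
            exact (norm_toEuclideanLin_le _ _).trans (by gcongr)
        _ = V * ‖g‖ ^ 2 := by ring
    have h4 := mul_le_mul_of_nonneg_left h3 (sq_nonneg η)
    simp only [map_zero, LinearMap.zero_apply, inner_zero_right, mul_zero, add_zero,
      integral_const, probReal_univ, one_smul]
    linarith
  calc _ ≤ ∫⁻ ω, ENNReal.ofReal (h ω) ∂P :=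
        lintegral_mono fun ω => ENNReal.ofReal_le_ofReal (hle ω)
    _ = ENNReal.ofReal (∫ ω, h ω ∂P) :=
        (ofReal_integral_eq_lintegral_ofReal hint (Filter.Eventually.of_forall hnn)).symm
    _ ≤ _ := ENNReal.ofReal_le_ofReal hval

end OneStep

/-! ### The spectral decomposition of the mean -/

section Spectral

variable {d : ℕ}

/-- The orthogonal projection onto the complement of the line spanned by `e`. -/
noncomputable def perp (e : EuclideanSpace ℝ (Fin d)) :
    EuclideanSpace ℝ (Fin d) →L[ℝ] EuclideanSpace ℝ (Fin d) :=
  (ℝ ∙ e)ᗮ.starProjection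

lemma norm_perp_le (e : EuclideanSpace ℝ (Fin d)) : ‖perp e‖ ≤ 1 :=
  Submodule.starProjection_norm_le _

lemma norm_perp_sq {e : EuclideanSpace ℝ (Fin d)} (he : ‖e‖ = 1) (x : EuclideanSpace ℝ (Fin d)) :
    ‖perp e x‖ ^ 2 = ‖x‖ ^ 2 - inner ℝ e x ^ 2 := by
  have h : perp e x = x - inner ℝ e x • e := by
    rw [perp, Submodule.starProjection_orthogonal_val, Submodule.starProjection_unit_singleton ℝ he]
  rw [h, norm_sub_sq_real, inner_smul_right, norm_smul, he, real_inner_comm x e, mul_one,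
    Real.norm_eq_abs, sq_abs]
  ring

variable {S : Matrix (Fin d) (Fin d) ℝ}
  {v : OrthonormalBasis (Fin d) ℝ (EuclideanSpace ℝ (Fin d))} {lam : Fin d → ℝ}

lemma norm_perp_basis_sq (i : Fin d) (x : EuclideanSpace ℝ (Fin d)) :
    ‖perp (v i) x‖ ^ 2 = ∑ j ∈ Finset.univ.erase i, inner ℝ (v j) x ^ 2 := by
  have h : ‖x‖ ^ 2 = ∑ j, inner ℝ (v j) x ^ 2 := by
    rw [← v.sum_sq_norm_inner_right x]
    simp
  rw [norm_perp_sq (v.orthonormal.1 i), h,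
    ← Finset.add_sum_erase _ _ (Finset.mem_univ i), add_sub_cancel_left]

/-- `i₀` and `i₁` are the indices of a largest and a second largest eigenvalue. -/
structure IsTopPair (lam : Fin d → ℝ) (i₀ i₁ : Fin d) : Prop where
  le_top : ∀ i, lam i ≤ lam i₀
  le_second : ∀ i, i ≠ i₀ → lam i ≤ lam i₁

lemma IsEigenDecomp.inner_eigen (hv : IsEigenDecomp S v lam) (hS : S.PosSemidef) (i : Fin d)
    (x : EuclideanSpace ℝ (Fin d)) :
    inner ℝ (v i) (Matrix.toEuclideanLin S x) = lam i * inner ℝ (v i) x := by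
  have hST : Sᵀ = S := by
    rw [← Matrix.conjTranspose_eq_transpose_of_trivial]
    exact hS.isHermitian
  rw [inner_toEuclideanLin_transpose, hST, hv.eigen, real_inner_smul_left]

lemma IsEigenDecomp.eigenvalue_nonneg (hv : IsEigenDecomp S v lam) (hS : S.PosSemidef)
    (i : Fin d) : 0 ≤ lam i := by
  have h1 : inner ℝ (v i) (Matrix.toEuclideanLin S (v i)) = lam i := by
    rw [hv.eigen, real_inner_smul_right, real_inner_self_eq_norm_sq, v.orthonormal.1 i]
    simp
  rw [← h1, real_inner_comm]
  have h2 := hS.dotProduct_mulVec_nonneg (v i)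
  simpa [PiLp.inner_apply, Matrix.toLpLin_apply, dotProduct, mul_comm] using h2

lemma IsEigenDecomp.inner_add_smul (hv : IsEigenDecomp S v lam) (hS : S.PosSemidef) (i : Fin d)
    (η : ℝ) (x : EuclideanSpace ℝ (Fin d)) :
    inner ℝ (v i) (x + η • Matrix.toEuclideanLin S x) = (1 + η * lam i) * inner ℝ (v i) x := by
  rw [inner_add_right, real_inner_smul_right, hv.inner_eigen hS]
  ring

lemma IsEigenDecomp.norm_add_smul_sq_le (hv : IsEigenDecomp S v lam) (hS : S.PosSemidef)
    {i₀ i₁ : Fin d} (hi : IsTopPair lam i₀ i₁) {η : ℝ} (hη : 0 ≤ η) (x : EuclideanSpace ℝ (Fin d)) :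
    ‖x + η • Matrix.toEuclideanLin S x‖ ^ 2 ≤ (1 + η * lam i₀) ^ 2 * ‖x‖ ^ 2 := by
  rw [← v.sum_sq_norm_inner_right x, ← v.sum_sq_norm_inner_right (_ + _), Finset.mul_sum]
  refine Finset.sum_le_sum fun i _ => ?_
  rw [hv.inner_add_smul hS, norm_mul, mul_pow, Real.norm_eq_abs, sq_abs]
  have h0 := hv.eigenvalue_nonneg hS i
  have h1 := hi.le_top i
  gcongr

/-- In eigencoordinates each component other than `i₀` is multiplied by `1 + η λᵢ`, which lies
between `0` and `1 + η λ_{i₁}` since the eigenvalues are non-negative. -/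
lemma IsEigenDecomp.norm_perp_add_smul_sq_le (hv : IsEigenDecomp S v lam) (hS : S.PosSemidef)
    {i₀ i₁ : Fin d} (hi : IsTopPair lam i₀ i₁) {η : ℝ} (hη : 0 ≤ η) (x : EuclideanSpace ℝ (Fin d)) :
    ‖perp (v i₀) (x + η • Matrix.toEuclideanLin S x)‖ ^ 2 ≤
      (1 + η * lam i₁) ^ 2 * ‖perp (v i₀) x‖ ^ 2 := by
  rw [norm_perp_basis_sq, norm_perp_basis_sq, Finset.mul_sum]
  refine Finset.sum_le_sum fun i hne => ?_
  rw [hv.inner_add_smul hS, mul_pow]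
  have h0 := hv.eigenvalue_nonneg hS i
  have h1 := hi.le_second i (Finset.ne_of_mem_erase hne)
  gcongr

end Spectral

/-! ### Unnormalised iterates and their adjoints -/

section Iterates

variable {d : ℕ}

/-- Oja's algorithm without normalisation. -/
noncomputable def ojaRaw (η : ℕ → ℝ) (w : EuclideanSpace ℝ (Fin d)) :
    (n : ℕ) → (Fin n → Matrix (Fin d) (Fin d) ℝ) → EuclideanSpace ℝ (Fin d)
  | 0, _ => w
  | n + 1, A => ojaRaw η w n (fun i => A i.castSucc) + η (n + 1) •
      Matrix.toEuclideanLin (A (Fin.last n)) (ojaRaw η w n fun i => A i.castSucc)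

/-- The adjoint of the linear map `w ↦ ojaRaw η w n A`. -/
noncomputable def ojaAdj (η : ℕ → ℝ) :
    (n : ℕ) → (Fin n → Matrix (Fin d) (Fin d) ℝ) → EuclideanSpace ℝ (Fin d) →
      EuclideanSpace ℝ (Fin d)
  | 0, _, y => y
  | n + 1, A, y => ojaAdj η n (fun i => A i.castSucc)
      (y + η (n + 1) • Matrix.toEuclideanLin (A (Fin.last n))ᵀ y)

/-- This separates the two sources of randomness: `ojaAdj` involves the matrices alone, so the start
enters only through one inner product. The adjoint applies the last matrix first, hence the
induction over all `y`. -/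
lemma inner_ojaRaw (η : ℕ → ℝ) (w : EuclideanSpace ℝ (Fin d)) (n : ℕ)
    (A : Fin n → Matrix (Fin d) (Fin d) ℝ) (y : EuclideanSpace ℝ (Fin d)) :
    inner ℝ y (ojaRaw η w n A) = inner ℝ (ojaAdj η n A y) w := by
  induction n generalizing y with
  | zero => rfl
  | succ n ih =>
    rw [ojaRaw, ojaAdj, ← ih, inner_add_right, inner_add_left, real_inner_smul_right,
      real_inner_smul_left, inner_toEuclideanLin_transpose]

lemma oja_eq_of_ojaRaw_ne_zero (η : ℕ → ℝ) {w : EuclideanSpace ℝ (Fin d)} (hw : ‖w‖ = 1) (n : ℕ)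
    (A : Fin n → Matrix (Fin d) (Fin d) ℝ) (h : ojaRaw η w n A ≠ 0) :
    oja η w n A = ‖ojaRaw η w n A‖⁻¹ • ojaRaw η w n A := by
  induction n with
  | zero => simp [oja, ojaRaw, hw]
  | succ n ih =>
    -- A raw iterate that vanishes stays zero, so a non-zero final one excludes every degenerate
    -- normalisation, where the default `0⁻¹ = 0` would intervene.
    have h' : ojaRaw η w n (fun i => A i.castSucc) ≠ 0 := fun h0 => h (by simp [ojaRaw, h0])
    have hc : 0 < ‖ojaRaw η w n (fun i => A i.castSucc)‖⁻¹ := inv_pos.2 (norm_pos_iff.2 h')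
    have hlin : ∀ (c : ℝ) (u : EuclideanSpace ℝ (Fin d)),
        c • u + η (n + 1) • Matrix.toEuclideanLin (A (Fin.last n)) (c • u) =
          c • (u + η (n + 1) • Matrix.toEuclideanLin (A (Fin.last n)) u) := by
      intro c u
      rw [map_smul, smul_add, smul_comm]
    rw [oja, ih _ h', ojaStep, hlin, norm_smul, norm_inv, norm_norm, mul_inv, inv_inv, smul_smul,
      mul_right_comm, mul_inv_cancel₀ (norm_ne_zero_iff.2 h'), one_mul]
    rfl

lemma continuous_ojaRaw (η : ℕ → ℝ) (n : ℕ) : Continuous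
    fun z : EuclideanSpace ℝ (Fin d) × (Fin n → Matrix (Fin d) (Fin d) ℝ) =>
      ojaRaw η z.1 n z.2 := by
  induction n with
  | zero => exact continuous_fst
  | succ n ih =>
    have h1 : Continuous fun z : EuclideanSpace ℝ (Fin d) ×
        (Fin (n + 1) → Matrix (Fin d) (Fin d) ℝ) => ojaRaw η z.1 n fun i => z.2 i.castSucc :=
      ih.comp (continuous_fst.prodMk
        (continuous_pi fun i => (continuous_apply i.castSucc).comp continuous_snd))
    have h2 : Continuous fun z : EuclideanSpace ℝ (Fin d) ×
        (Fin (n + 1) → Matrix (Fin d) (Fin d) ℝ) => z.2 (Fin.last n) :=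
      (continuous_apply _).comp continuous_snd
    have h3 := continuous_toEuclideanLin.comp (h2.prodMk h1)
    exact h1.add (h3.const_smul (η (n + 1)))

lemma continuous_ojaAdj (η : ℕ → ℝ) (n : ℕ) : Continuous
    fun z : (Fin n → Matrix (Fin d) (Fin d) ℝ) × EuclideanSpace ℝ (Fin d) =>
      ojaAdj η n z.1 z.2 := by
  induction n with
  | zero => exact continuous_snd
  | succ n ih =>
    have h1 : Continuous fun z : (Fin (n + 1) → Matrix (Fin d) (Fin d) ℝ) ×
        EuclideanSpace ℝ (Fin d) => (z.1 (Fin.last n))ᵀ :=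
      Continuous.matrix_transpose ((continuous_apply (Fin.last n)).comp continuous_fst)
    have h2 := continuous_toEuclideanLin.comp (h1.prodMk continuous_snd)
    exact ih.comp ((continuous_pi fun i => (continuous_apply i.castSucc).comp continuous_fst).prodMk
      (continuous_snd.add (h2.const_smul (η (n + 1)))))

end Iterates

/-! ### Consequences of the model assumptions -/

section ModelLemmas

variable {Ω : Type*} [MeasurableSpace Ω] {P : Measure Ω} {d n : ℕ}
  {A : Fin n → Ω → Matrix (Fin d) (Fin d) ℝ} {S : Matrix (Fin d) (Fin d) ℝ} {M V : ℝ}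

lemma lintegral_indepFun [IsProbabilityMeasure P] {α β : Type*} [MeasurableSpace α]
    [MeasurableSpace β] {X : Ω → α} {Y : Ω → β} (hX : Measurable X) (hY : Measurable Y)
    (h : IndepFun X Y P) {f : α × β → ℝ≥0∞} (hf : Measurable f) :
    ∫⁻ ω, f (X ω, Y ω) ∂P = ∫⁻ ω, ∫⁻ ω', f (X ω, Y ω') ∂P ∂P := by
  have := Measure.isProbabilityMeasure_map (μ := P) hX.aemeasurable
  have := Measure.isProbabilityMeasure_map (μ := P) hY.aemeasurable
  rw [← lintegral_map hf (hX.prodMk hY),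
    (indepFun_iff_map_prod_eq_prod_map_map hX.aemeasurable hY.aemeasurable).1 h,
    lintegral_prod _ hf.aemeasurable, lintegral_map hf.lintegral_prod_right' hX]
  refine lintegral_congr fun ω => ?_
  exact lintegral_map (hf.comp measurable_prodMk_left) hY

lemma Model.variance_nonneg (h : Model P A S M V) (i : Fin n) : 0 ≤ V :=
  (norm_nonneg _).trans ((le_max_left _ _).trans (h.variance i))

lemma Model.castSucc {A : Fin (n + 1) → Ω → Matrix (Fin d) (Fin d) ℝ} (h : Model P A S M V) :
    Model P (fun i : Fin n => A i.castSucc) S M V where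
  measurable _ := h.measurable _
  indep := h.indep.precomp (Fin.castSucc_injective n)
  posSemidef := h.posSemidef
  mean _ := h.mean _
  bounded _ := h.bounded _
  variance _ := h.variance _

lemma Model.measurable_pi (h : Model P A S M V) : Measurable fun ω i => A i ω :=
  measurable_pi_lambda _ h.measurable

lemma Model.indepFun_castSucc_last {A : Fin (n + 1) → Ω → Matrix (Fin d) (Fin d) ℝ}
    (h : Model P A S M V) :
    IndepFun (fun ω (i : Fin n) => A i.castSucc ω) (A (Fin.last n)) P := by
  have hd : Disjoint (Finset.univ.erase (Fin.last n)) {Fin.last n} := by simp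
  have h1 := h.indep.indepFun_finset _ _ hd h.measurable
  let φ : ((Finset.univ.erase (Fin.last n) : Finset (Fin (n + 1))) →
      Matrix (Fin d) (Fin d) ℝ) → Fin n → Matrix (Fin d) (Fin d) ℝ :=
    fun f i => f ⟨i.castSucc, by simp [Fin.castSucc_ne_last]⟩
  let ψ : (({Fin.last n} : Finset (Fin (n + 1))) → Matrix (Fin d) (Fin d) ℝ) →
      Matrix (Fin d) (Fin d) ℝ := fun f => f ⟨Fin.last n, by simp⟩
  have hφ : Measurable φ := measurable_pi_lambda _ fun i => measurable_pi_apply _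
  have hψ : Measurable ψ := measurable_pi_apply _
  exact h1.comp hφ hψ

lemma Model.matExp_sub [IsProbabilityMeasure P] (h : Model P A S M V) (i : Fin n) :
    matExp P (fun ω => A i ω - S) = 0 := by
  have hm : Measurable fun ω => A i ω - S := (h.measurable i).sub_const S
  ext j k
  have hint := integrable_entry hm (h.bounded i) j k
  have hA : Integrable (fun ω => A i ω j k) P := by
    have := hint.add (integrable_const (S j k))
    simpa [Pi.add_def] using this
  have hmean : ∫ ω, A i ω j k ∂P = S j k := congrFun (congrFun (h.mean i) j) k
  simp only [matExp, Matrix.of_apply, Matrix.sub_apply, Matrix.zero_apply]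
  rw [integral_sub hA (integrable_const _), hmean]
  simp

lemma Model.lintegral_step_le [IsProbabilityMeasure P] (h : Model P A S M V) (i : Fin n)
    {F : Type*} [NormedAddCommGroup F] [InnerProductSpace ℝ F] [CompleteSpace F]
    (T : EuclideanSpace ℝ (Fin d) →L[ℝ] F) (hT : ‖T‖ ≤ 1) (p : F) (g : EuclideanSpace ℝ (Fin d))
    (η : ℝ) :
    ∫⁻ ω, ENNReal.ofReal (‖p + η • T (Matrix.toEuclideanLin (A i ω - S) g)‖ ^ 2) ∂P ≤
      ENNReal.ofReal (‖p‖ ^ 2 + η ^ 2 * V * ‖g‖ ^ 2) :=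
  lintegral_norm_add_smul_sq_le ((h.measurable i).sub_const S) (h.matExp_sub i) (h.bounded i)
    ((le_max_right _ _).trans (h.variance i)) T hT p g η

/-- Transposing exchanges the two halves of the variance assumption; here the bound on `E[(A - S)(A
- S)ᵀ]` is needed. -/
lemma Model.lintegral_step_transpose_le [IsProbabilityMeasure P] (h : Model P A S M V) (i : Fin n)
    (p g : EuclideanSpace ℝ (Fin d)) (η : ℝ) :
    ∫⁻ ω, ENNReal.ofReal (‖p + η • Matrix.toEuclideanLin (A i ω - S)ᵀ g‖ ^ 2) ∂P ≤
      ENNReal.ofReal (‖p‖ ^ 2 + η ^ 2 * V * ‖g‖ ^ 2) := by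
  have hmean : matExp P (fun ω => (A i ω - S)ᵀ) = 0 := by
    ext j k
    exact congrFun (congrFun (h.matExp_sub i) k) j
  refine lintegral_norm_add_smul_sq_le (X := fun ω => (A i ω - S)ᵀ) (M := M)
    (measurable_transpose.comp ((h.measurable i).sub_const S)) hmean ?_ ?_
    (ContinuousLinearMap.id ℝ _) ContinuousLinearMap.norm_id_le p g η
  · filter_upwards [h.bounded i] with ω hω
    rwa [norm_transpose]
  · simp only [Matrix.transpose_transpose]
    exact (le_max_left _ _).trans (h.variance i)

end ModelLemmas

/-! ### Moment bounds for the iterates -/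

section Moments

variable {Ω : Type*} [MeasurableSpace Ω] {P : Measure Ω} [IsProbabilityMeasure P] {d n : ℕ}
  {S : Matrix (Fin d) (Fin d) ℝ} {M V : ℝ} {η : ℕ → ℝ}
  {v : OrthonormalBasis (Fin d) ℝ (EuclideanSpace ℝ (Fin d))} {lam : Fin d → ℝ}

/-- The mean growth of the top component after `n` steps. -/
noncomputable def topGrowth (η : ℕ → ℝ) (lam1 : ℝ) (n : ℕ) : ℝ :=
  ∏ i ∈ Finset.range n, (1 + η (i + 1) * lam1)

/-- The growth of second moments after `n` steps. -/
noncomputable def sqGrowth (η : ℕ → ℝ) (lam1 V : ℝ) (n : ℕ) : ℝ :=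
  ∏ i ∈ Finset.range n, ((1 + η (i + 1) * lam1) ^ 2 + η (i + 1) ^ 2 * V)

/-- The recursion that bounds the mean square of the component orthogonal to the top direction,
for a uniformly random start in dimension `d`. -/
noncomputable def perpBound (η : ℕ → ℝ) (lam1 lam2 V : ℝ) (d : ℕ) : ℕ → ℝ
  | 0 => 1
  | n + 1 => ((1 + η (n + 1) * lam2) ^ 2 + η (n + 1) ^ 2 * V) * perpBound η lam1 lam2 V d n +
      η (n + 1) ^ 2 * V * (sqGrowth η lam1 V n / d)

lemma topGrowth_succ (lam1 : ℝ) (n : ℕ) :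
    topGrowth η lam1 (n + 1) = topGrowth η lam1 n * (1 + η (n + 1) * lam1) :=
  Finset.prod_range_succ _ _

lemma sqGrowth_succ (lam1 : ℝ) (n : ℕ) : sqGrowth η lam1 V (n + 1) =
    sqGrowth η lam1 V n * ((1 + η (n + 1) * lam1) ^ 2 + η (n + 1) ^ 2 * V) :=
  Finset.prod_range_succ _ _

lemma sqGrowth_nonneg (hV : 0 ≤ V) (lam1 : ℝ) (n : ℕ) : 0 ≤ sqGrowth η lam1 V n :=
  Finset.prod_nonneg fun _ _ => by positivity

lemma perpBound_nonneg (hV : 0 ≤ V) (lam1 lam2 : ℝ) (d n : ℕ) :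
    0 ≤ perpBound η lam1 lam2 V d n := by
  induction n with
  | zero => exact zero_le_one
  | succ n ih =>
    have := sqGrowth_nonneg (η := η) hV lam1 n
    rw [perpBound]
    positivity

lemma topGrowth_sq_le_sqGrowth (hV : 0 ≤ V) {lam1 : ℝ} (n : ℕ) :
    topGrowth η lam1 n ^ 2 ≤ sqGrowth η lam1 V n := by
  rw [topGrowth, sqGrowth, ← Finset.prod_pow]
  refine Finset.prod_le_prod (fun i _ => sq_nonneg _) fun i _ => ?_
  nlinarith [mul_nonneg (sq_nonneg (η (i + 1))) hV]

/-- A single step conditioned on the past, used with three maps `T`: the identity, the pairing with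
`e`, and the projection `perp e`. -/
lemma Model.lintegral_norm_map_sub_sq_le {A : Fin n → Ω → Matrix (Fin d) (Fin d) ℝ}
    (h : Model P A S M V) (i : Fin n)
    {F : Type*} [NormedAddCommGroup F] [InnerProductSpace ℝ F] [CompleteSpace F]
    (T : EuclideanSpace ℝ (Fin d) →L[ℝ] F) (hT : ‖T‖ ≤ 1) (c : F) (u : EuclideanSpace ℝ (Fin d))
    (a : ℝ) :
    ∫⁻ ω, ENNReal.ofReal (‖T (u + a • Matrix.toEuclideanLin (A i ω) u) - c‖ ^ 2) ∂P ≤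
      ENNReal.ofReal (‖T (u + a • Matrix.toEuclideanLin S u) - c‖ ^ 2 + a ^ 2 * V * ‖u‖ ^ 2) := by
  refine le_trans (le_of_eq (lintegral_congr fun ω => ?_)) (h.lintegral_step_le i T hT _ u a)
  congr 3
  rw [map_sub, LinearMap.sub_apply, map_sub, map_add, map_add, map_smul, map_smul, smul_sub]
  abel

lemma Model.lintegral_ojaRaw_succ {A : Fin (n + 1) → Ω → Matrix (Fin d) (Fin d) ℝ}
    (h : Model P A S M V) (w : EuclideanSpace ℝ (Fin d))
    {f : EuclideanSpace ℝ (Fin d) → ℝ≥0∞} (hf : Measurable f) :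
    ∫⁻ ω, f (ojaRaw η w (n + 1) fun i => A i ω) ∂P =
      ∫⁻ ω, ∫⁻ ω', f ((ojaRaw η w n fun i => A i.castSucc ω) + η (n + 1) •
        Matrix.toEuclideanLin (A (Fin.last n) ω') (ojaRaw η w n fun i => A i.castSucc ω)) ∂P ∂P := by
  have h1 : Continuous fun z : (Fin n → Matrix (Fin d) (Fin d) ℝ) × Matrix (Fin d) (Fin d) ℝ =>
      ojaRaw η w n z.1 :=
    (continuous_ojaRaw η n).comp (continuous_const.prodMk continuous_fst)
  have h2 := continuous_toEuclideanLin.comp (continuous_snd.prodMk h1)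
  exact lintegral_indepFun h.castSucc.measurable_pi (h.measurable _) h.indepFun_castSucc_last
    (hf.comp (h1.add (h2.const_smul (η (n + 1)))).measurable)

variable {i₀ i₁ : Fin d} (hv : IsEigenDecomp S v lam) (hi : IsTopPair lam i₀ i₁) (hη : ∀ i, 0 ≤ η i)
  (hV : 0 ≤ V)

include hv hi hη hV

/-- The last matrix acts first on `y`. The earlier ones are integrated out with the last one frozen,
by the induction hypothesis at the updated vector; then the last one is averaged. -/
lemma Model.lintegral_norm_ojaAdj_sq_le {A : Fin n → Ω → Matrix (Fin d) (Fin d) ℝ}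
    (h : Model P A S M V) (y : EuclideanSpace ℝ (Fin d)) :
    ∫⁻ ω, ENNReal.ofReal (‖ojaAdj η n (fun i => A i ω) y‖ ^ 2) ∂P ≤
      ENNReal.ofReal (sqGrowth η (lam i₀) V n * ‖y‖ ^ 2) := by
  induction n generalizing y with
  | zero => simp [ojaAdj, sqGrowth]
  | succ n ih =>
    have hc : Continuous fun z : Matrix (Fin d) (Fin d) ℝ × (Fin n → Matrix (Fin d) (Fin d) ℝ) =>
        ojaAdj η n z.2 (y + η (n + 1) • Matrix.toEuclideanLin z.1ᵀ y) := by
      have h1 := continuous_toEuclideanLin.comp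
        ((Continuous.matrix_transpose (continuous_fst (X := Matrix (Fin d) (Fin d) ℝ)
          (Y := Fin n → Matrix (Fin d) (Fin d) ℝ))).prodMk (continuous_const (y := y)))
      exact (continuous_ojaAdj η n).comp
        (continuous_snd.prodMk (continuous_const.add (h1.const_smul (η (n + 1)))))
    have hST : Sᵀ = S := by
      rw [← Matrix.conjTranspose_eq_transpose_of_trivial]
      exact h.posSemidef.isHermitian
    calc _ = ∫⁻ ω', ∫⁻ ω, ENNReal.ofReal (‖ojaAdj η n (fun i => A i.castSucc ω)
              (y + η (n + 1) • Matrix.toEuclideanLin (A (Fin.last n) ω')ᵀ y)‖ ^ 2) ∂P ∂P :=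
          lintegral_indepFun (h.measurable _) h.castSucc.measurable_pi
            h.indepFun_castSucc_last.symm (hc.norm.pow 2).measurable.ennreal_ofReal
      _ ≤ ∫⁻ ω', ENNReal.ofReal (sqGrowth η (lam i₀) V n) * ENNReal.ofReal
            (‖(y + η (n + 1) • Matrix.toEuclideanLin S y) +
              η (n + 1) • Matrix.toEuclideanLin (A (Fin.last n) ω' - S)ᵀ y‖ ^ 2) ∂P := by
          refine lintegral_mono fun ω' => (ih h.castSucc _).trans (le_of_eq ?_)
          rw [ENNReal.ofReal_mul (sqGrowth_nonneg hV _ _), Matrix.transpose_sub, hST, map_sub,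
            LinearMap.sub_apply, smul_sub]
          congr 4
          abel
      _ = ENNReal.ofReal (sqGrowth η (lam i₀) V n) * ∫⁻ ω', ENNReal.ofReal
            (‖(y + η (n + 1) • Matrix.toEuclideanLin S y) +
              η (n + 1) • Matrix.toEuclideanLin (A (Fin.last n) ω' - S)ᵀ y‖ ^ 2) ∂P :=
          lintegral_const_mul' _ _ ENNReal.ofReal_ne_top
      _ ≤ ENNReal.ofReal (sqGrowth η (lam i₀) V n) * ENNReal.ofReal
            (((1 + η (n + 1) * lam i₀) ^ 2 + η (n + 1) ^ 2 * V) * ‖y‖ ^ 2) := by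
          gcongr
          refine (h.lintegral_step_transpose_le _ _ _ _).trans (ENNReal.ofReal_le_ofReal ?_)
          linarith [hv.norm_add_smul_sq_le h.posSemidef hi (hη (n + 1)) y]
      _ = _ := by
          rw [← ENNReal.ofReal_mul (sqGrowth_nonneg hV _ _), sqGrowth_succ, mul_assoc]

lemma Model.lintegral_norm_ojaRaw_sq_le {A : Fin n → Ω → Matrix (Fin d) (Fin d) ℝ}
    (h : Model P A S M V) (w : EuclideanSpace ℝ (Fin d)) :
    ∫⁻ ω, ENNReal.ofReal (‖ojaRaw η w n fun i => A i ω‖ ^ 2) ∂P ≤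
      ENNReal.ofReal (sqGrowth η (lam i₀) V n * ‖w‖ ^ 2) := by
  induction n with
  | zero => simp [ojaRaw, sqGrowth]
  | succ n ih =>
    set r := (1 + η (n + 1) * lam i₀) ^ 2 + η (n + 1) ^ 2 * V with hr
    have hr0 : 0 ≤ r := by positivity
    rw [h.lintegral_ojaRaw_succ w (f := fun u => ENNReal.ofReal (‖u‖ ^ 2)) (by fun_prop)]
    calc _ ≤ ∫⁻ ω, ENNReal.ofReal r *
            ENNReal.ofReal (‖ojaRaw η w n fun i => A i.castSucc ω‖ ^ 2) ∂P := by
          refine lintegral_mono fun ω => ?_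
          have h1 := h.lintegral_norm_map_sub_sq_le (Fin.last n) (ContinuousLinearMap.id ℝ _)
            ContinuousLinearMap.norm_id_le 0 (ojaRaw η w n fun i => A i.castSucc ω) (η (n + 1))
          simp only [ContinuousLinearMap.id_apply, sub_zero] at h1
          refine h1.trans ?_
          rw [← ENNReal.ofReal_mul hr0]
          refine ENNReal.ofReal_le_ofReal ?_
          have h2 := hv.norm_add_smul_sq_le h.posSemidef hi (hη (n + 1))
            (ojaRaw η w n fun i => A i.castSucc ω)
          rw [hr]
          linarith
      _ = ENNReal.ofReal r * ∫⁻ ω, ENNReal.ofReal (‖ojaRaw η w n fun i => A i.castSucc ω‖ ^ 2) ∂P :=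
          lintegral_const_mul' _ _ ENNReal.ofReal_ne_top
      _ ≤ ENNReal.ofReal r * ENNReal.ofReal (sqGrowth η (lam i₀) V n * ‖w‖ ^ 2) := by
          gcongr
          exact ih h.castSucc
      _ = _ := by
          rw [← ENNReal.ofReal_mul hr0, sqGrowth_succ]
          congr 1
          ring

/-- A variance bound for `⟨e, B e⟩`. Writing `s` for `sqGrowth` and `m` for `topGrowth`, `s - m²`
solves exactly the recursion `D ↦ (1 + η λ₁)² D + η² V s` satisfied by the estimate. -/
lemma Model.lintegral_inner_ojaRaw_sub_sq_le {A : Fin n → Ω → Matrix (Fin d) (Fin d) ℝ}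
    (h : Model P A S M V) :
    ∫⁻ ω, ENNReal.ofReal ((inner ℝ (v i₀)
        (ojaRaw η (v i₀) n fun i => A i ω) - topGrowth η (lam i₀) n) ^ 2) ∂P ≤
      ENNReal.ofReal (sqGrowth η (lam i₀) V n -
        topGrowth η (lam i₀) n ^ 2) := by
  set e := v i₀ with he
  set l := lam i₀ with hl
  have he1 : ‖e‖ = 1 := v.orthonormal.1 _
  induction n with
  | zero => simp [ojaRaw, sqGrowth, topGrowth, he1]
  | succ n ih =>
    set u : Ω → EuclideanSpace ℝ (Fin d) := fun ω => ojaRaw η e n fun i => A i.castSucc ω with hu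
    have hum : Measurable u := ((continuous_ojaRaw η n).comp
      (continuous_const.prodMk continuous_id)).measurable.comp h.castSucc.measurable_pi
    rw [h.lintegral_ojaRaw_succ e
      (f := fun u => ENNReal.ofReal ((inner ℝ e u - topGrowth η l (n + 1)) ^ 2)) (by fun_prop)]
    have hle : 0 ≤ sqGrowth η l V n - topGrowth η l n ^ 2 :=
      sub_nonneg.2 (topGrowth_sq_le_sqGrowth hV n)
    calc _ ≤ ∫⁻ ω, (ENNReal.ofReal ((1 + η (n + 1) * l) ^ 2) *
              ENNReal.ofReal ((inner ℝ e (u ω) - topGrowth η l n) ^ 2) +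
            ENNReal.ofReal (η (n + 1) ^ 2 * V) * ENNReal.ofReal (‖u ω‖ ^ 2)) ∂P := by
          refine lintegral_mono fun ω => ?_
          have h1 := h.lintegral_norm_map_sub_sq_le (Fin.last n) (innerSL ℝ e)
            (by rw [innerSL_apply_norm, he1]) (topGrowth η l (n + 1)) (u ω) (η (n + 1))
          simp only [innerSL_apply_apply, Real.norm_eq_abs, sq_abs] at h1
          refine h1.trans (le_of_eq ?_)
          rw [← ENNReal.ofReal_mul (sq_nonneg _), ← ENNReal.ofReal_mul (by positivity),
            ← ENNReal.ofReal_add (by positivity) (by positivity), he,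
            hv.inner_add_smul h.posSemidef, topGrowth_succ]
          congr 1
          ring
      _ = ENNReal.ofReal ((1 + η (n + 1) * l) ^ 2) *
              ∫⁻ ω, ENNReal.ofReal ((inner ℝ e (u ω) - topGrowth η l n) ^ 2) ∂P +
            ENNReal.ofReal (η (n + 1) ^ 2 * V) * ∫⁻ ω, ENNReal.ofReal (‖u ω‖ ^ 2) ∂P := by
          rw [lintegral_add_right _ (by fun_prop), lintegral_const_mul' _ _ ENNReal.ofReal_ne_top,
            lintegral_const_mul' _ _ ENNReal.ofReal_ne_top]
      _ ≤ ENNReal.ofReal ((1 + η (n + 1) * l) ^ 2) *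
              ENNReal.ofReal (sqGrowth η l V n - topGrowth η l n ^ 2) +
            ENNReal.ofReal (η (n + 1) ^ 2 * V) * ENNReal.ofReal (sqGrowth η l V n * ‖e‖ ^ 2) := by
          gcongr
          · exact ih h.castSucc
          · exact h.castSucc.lintegral_norm_ojaRaw_sq_le hv hi hη hV e
      _ = _ := by
          have h0 := sqGrowth_nonneg (η := η) hV l n
          rw [he1, ← ENNReal.ofReal_mul (sq_nonneg _), ← ENNReal.ofReal_mul (by positivity),
            ← ENNReal.ofReal_add (by positivity) (by positivity), topGrowth_succ, sqGrowth_succ]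
          congr 1
          ring

/-- The noise term `η² V ‖u‖²` is split by Pythagoras: the orthogonal part joins the contraction
factor, the part along `e` is the leakage. -/
lemma Model.lintegral_norm_perp_ojaRaw_succ_sq_le
    {A : Fin (n + 1) → Ω → Matrix (Fin d) (Fin d) ℝ} (h : Model P A S M V)
    (w : EuclideanSpace ℝ (Fin d)) :
    ∫⁻ ω, ENNReal.ofReal (‖perp (v i₀) (ojaRaw η w (n + 1) fun i => A i ω)‖ ^ 2) ∂P ≤
      ENNReal.ofReal ((1 + η (n + 1) * lam i₁) ^ 2 + η (n + 1) ^ 2 * V) *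
        ∫⁻ ω, ENNReal.ofReal
          (‖perp (v i₀) (ojaRaw η w n fun i => A i.castSucc ω)‖ ^ 2) ∂P +
      ENNReal.ofReal (η (n + 1) ^ 2 * V) * ∫⁻ ω, ENNReal.ofReal
        (inner ℝ (v i₀) (ojaRaw η w n fun i => A i.castSucc ω) ^ 2) ∂P := by
  set e := v i₀ with he
  have he1 : ‖e‖ = 1 := v.orthonormal.1 _
  set u : Ω → EuclideanSpace ℝ (Fin d) := fun ω => ojaRaw η w n fun i => A i.castSucc ω with hu
  have hum : Measurable u := ((continuous_ojaRaw η n).comp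
    (continuous_const.prodMk continuous_id)).measurable.comp h.castSucc.measurable_pi
  have hinner : Measurable fun ω => ENNReal.ofReal (inner ℝ e (u ω) ^ 2) := by fun_prop
  have hr0 : 0 ≤ (1 + η (n + 1) * lam i₁) ^ 2 + η (n + 1) ^ 2 * V := by positivity
  rw [h.lintegral_ojaRaw_succ w (f := fun u => ENNReal.ofReal (‖perp e u‖ ^ 2)) (by fun_prop),
    ← lintegral_const_mul' _ _ ENNReal.ofReal_ne_top,
    ← lintegral_const_mul' _ _ ENNReal.ofReal_ne_top, ← lintegral_add_right _ (hinner.const_mul _)]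
  refine lintegral_mono fun ω => ?_
  have h1 := h.lintegral_norm_map_sub_sq_le (Fin.last n) (perp e) (norm_perp_le e) 0 (u ω)
    (η (n + 1))
  simp only [sub_zero] at h1
  refine h1.trans ?_
  rw [← ENNReal.ofReal_mul hr0, ← ENNReal.ofReal_mul (by positivity),
    ← ENNReal.ofReal_add (by positivity) (by positivity)]
  refine ENNReal.ofReal_le_ofReal ?_
  have h2 := hv.norm_perp_add_smul_sq_le h.posSemidef hi (hη (n + 1)) (u ω)
  have h3 := norm_perp_sq he1 (u ω)
  have h4 : η (n + 1) ^ 2 * V * ‖u ω‖ ^ 2 =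
      η (n + 1) ^ 2 * V * (‖perp e (u ω)‖ ^ 2 + inner ℝ e (u ω) ^ 2) := by
    rw [h3]
    ring
  linarith

lemma Model.lintegral_uniformSphere_perp_le {A : Fin n → Ω → Matrix (Fin d) (Fin d) ℝ}
    (h : Model P A S M V) :
    ∫⁻ w, ∫⁻ ω, ENNReal.ofReal
        (‖perp (v i₀) (ojaRaw η w n fun i => A i ω)‖ ^ 2) ∂P ∂uniformSphere d ≤
      ENNReal.ofReal (perpBound η (lam i₀) (lam i₁) V d n) := by
  have hd0 : 0 < d := i₀.pos
  have := isProbabilityMeasure_uniformSphere hd0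
  set e := v i₀ with he
  have he1 : ‖e‖ = 1 := v.orthonormal.1 _
  induction n with
  | zero =>
    simp only [ojaRaw, lintegral_const, measure_univ, mul_one, perpBound]
    calc _ ≤ ∫⁻ _, 1 ∂uniformSphere d := by
          refine lintegral_mono_ae ?_
          filter_upwards [ae_uniformSphere_norm] with w hw
          rw [norm_perp_sq he1, hw]
          refine ENNReal.ofReal_le_one.2 ?_
          nlinarith [sq_nonneg (inner ℝ e w)]
      _ = _ := by simp
  | succ n ih =>
    set l := lam i₀ with hl
    have hm : Measurable fun z : EuclideanSpace ℝ (Fin d) × Ω =>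
        ojaRaw η z.1 n fun i => A i.castSucc z.2 :=
      (continuous_ojaRaw η n).measurable.comp
        (measurable_fst.prodMk (h.castSucc.measurable_pi.comp measurable_snd))
    have hm1 : Measurable fun z : EuclideanSpace ℝ (Fin d) × Ω =>
        ENNReal.ofReal (inner ℝ e (ojaRaw η z.1 n fun i => A i.castSucc z.2) ^ 2) := by
      fun_prop
    have hr0 : 0 ≤ (1 + η (n + 1) * lam i₁) ^ 2 + η (n + 1) ^ 2 * V := by positivity
    -- After exchanging the integrals and passing to the adjoint, averaging over the sphere produces
    -- the decisive factor `1 / d`.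
    have htop : ∫⁻ w, ∫⁻ ω, ENNReal.ofReal
        (inner ℝ e (ojaRaw η w n fun i => A i.castSucc ω) ^ 2) ∂P ∂uniformSphere d ≤
        ENNReal.ofReal (sqGrowth η l V n / d) := by
      rw [lintegral_lintegral_swap hm1.aemeasurable]
      simp only [inner_ojaRaw, lintegral_uniformSphere_inner_sq hd0]
      have hd' : (0 : ℝ) < d := by exact_mod_cast hd0
      calc _ = ∫⁻ ω, ENNReal.ofReal (1 / d) *
              ENNReal.ofReal (‖ojaAdj η n (fun i => A i.castSucc ω) e‖ ^ 2) ∂P := by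
            refine lintegral_congr fun ω => ?_
            rw [← ENNReal.ofReal_mul (by positivity), one_div_mul_eq_div]
        _ = ENNReal.ofReal (1 / d) * ∫⁻ ω,
              ENNReal.ofReal (‖ojaAdj η n (fun i => A i.castSucc ω) e‖ ^ 2) ∂P :=
            lintegral_const_mul' _ _ ENNReal.ofReal_ne_top
        _ ≤ ENNReal.ofReal (1 / d) * ENNReal.ofReal (sqGrowth η l V n * ‖e‖ ^ 2) := by
            gcongr
            exact h.castSucc.lintegral_norm_ojaAdj_sq_le hv hi hη hV e
        _ = _ := by
            rw [← ENNReal.ofReal_mul (by positivity), he1, one_pow, mul_one, one_div_mul_eq_div]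
    calc _ ≤ _ := lintegral_mono fun w =>
          h.lintegral_norm_perp_ojaRaw_succ_sq_le hv hi hη hV w
      _ = _ := by
          rw [lintegral_add_right _ (hm1.lintegral_prod_right'.const_mul _),
            lintegral_const_mul' _ _ ENNReal.ofReal_ne_top,
            lintegral_const_mul' _ _ ENNReal.ofReal_ne_top]
      _ ≤ _ := add_le_add (mul_le_mul_right (ih h.castSucc) _) (mul_le_mul_right htop _)
      _ = _ := by
          have h0 := sqGrowth_nonneg (η := η) hV l n
          have h1 := perpBound_nonneg (η := η) hV l (lam i₁) d n
          rw [← ENNReal.ofReal_mul hr0, ← ENNReal.ofReal_mul (by positivity),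
            ← ENNReal.ofReal_add (by positivity) (by positivity), perpBound]

end Moments

/-! ### Bounds for the recursions with the prescribed step sizes -/

section StepSizes

variable {gap β lam1 lam2 V : ℝ}

lemma stepSize_nonneg (hgap : 0 < gap) (hβ : 0 < β) (i : ℕ) : 0 ≤ stepSize gap β i := by
  rw [stepSize]
  positivity

lemma stepSize_succ_sq_mul (hgap : 0 < gap) (hβ : 0 < β) (n : ℕ) (c : ℝ) :
    stepSize gap β (n + 1) ^ 2 * c = 36 * (c / gap ^ 2) / (β + n + 1) ^ 2 := by
  rw [stepSize]
  push_cast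
  have : β + (n + 1) ≠ 0 := by positivity
  have : β + n + 1 ≠ 0 := by positivity
  field_simp
  norm_num
  ring

/-- Telescoping form of `1 / t² ≤ 1 / (t - 1) - 1 / t`: the sum of all `ηᵢ² c` stays below `36 c /
(gap² β)`. -/
lemma stepSize_succ_sq_mul_le (hgap : 0 < gap) (hβ : 0 < β) (n : ℕ) {c : ℝ} (hc : 0 ≤ c) :
    stepSize gap β (n + 1) ^ 2 * c ≤
      36 * (c / gap ^ 2) * (1 / β - 1 / (β + (n + 1 : ℕ))) -
        36 * (c / gap ^ 2) * (1 / β - 1 / (β + n)) := by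
  rw [stepSize_succ_sq_mul hgap hβ, ← mul_sub, mul_div_assoc, div_eq_mul_one_div (c / gap ^ 2),
    mul_assoc]
  have h1 : 0 < β + n := by positivity
  have h2 : 1 / (β + n + 1) ^ 2 ≤ 1 / β - 1 / (β + (n + 1 : ℕ)) - (1 / β - 1 / (β + n)) := by
    have h3 : 1 / β - 1 / (β + (n + 1 : ℕ)) - (1 / β - 1 / (β + n)) =
        1 / ((β + n) * (β + n + 1)) := by
      push_cast
      have : β + (n + 1) ≠ 0 := by positivity
      field_simp
      ring
    rw [h3]
    gcongr
    nlinarith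
  have h4 : 0 ≤ c / gap ^ 2 := by positivity
  gcongr

/-- Each factor exceeds `(1 + η λ₁)²` by at most a factor `1 + η² V ≤ exp (η² V)`. The extra `λ₁²`
gives the same exponent as in the bound for `perpBound`. -/
lemma sqGrowth_le (hgap : 0 < gap) (hβ : 0 < β) (hlam : 0 ≤ lam1) (hV : 0 ≤ V) (n : ℕ) :
    sqGrowth (stepSize gap β) lam1 V n ≤ topGrowth (stepSize gap β) lam1 n ^ 2 *
      Real.exp (36 * ((V + lam1 ^ 2) / gap ^ 2) * (1 / β - 1 / (β + n))) := by
  induction n with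
  | zero => simp [sqGrowth, topGrowth]
  | succ n ih =>
    have ha := stepSize_nonneg hgap hβ (n + 1)
    have h1 := stepSize_succ_sq_mul_le hgap hβ n (c := V + lam1 ^ 2) (by positivity)
    rw [sqGrowth_succ, topGrowth_succ]
    set a := stepSize gap β (n + 1)
    set K := 36 * ((V + lam1 ^ 2) / gap ^ 2)
    clear_value a K
    have h2 : (1 + a * lam1) ^ 2 + a ^ 2 * V ≤ (1 + a * lam1) ^ 2 * Real.exp
        (K * (1 / β - 1 / (β + (n + 1 : ℕ))) - K * (1 / β - 1 / (β + n))) := by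
      have h3 : 1 + a ^ 2 * V ≤ Real.exp
          (K * (1 / β - 1 / (β + (n + 1 : ℕ))) - K * (1 / β - 1 / (β + n))) := by
        refine le_trans ?_ (Real.exp_le_exp.2 h1)
        have := Real.add_one_le_exp (a ^ 2 * (V + lam1 ^ 2))
        nlinarith [mul_nonneg (sq_nonneg a) (sq_nonneg lam1)]
      have h4 : 1 ≤ (1 + a * lam1) ^ 2 := one_le_pow₀ (by linarith [mul_nonneg ha hlam])
      have h5 : 0 ≤ a ^ 2 * V := by positivity
      calc _ ≤ (1 + a * lam1) ^ 2 * (1 + a ^ 2 * V) := by nlinarith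
        _ ≤ _ := by gcongr
    calc _ ≤ topGrowth (stepSize gap β) lam1 n ^ 2 * Real.exp (K * (1 / β - 1 / (β + n))) *
          ((1 + a * lam1) ^ 2 * Real.exp
            (K * (1 / β - 1 / (β + (n + 1 : ℕ))) - K * (1 / β - 1 / (β + n)))) := by
          gcongr
      _ = _ := by
          rw [Real.exp_sub]
          field_simp

/-- With `a` the step size and `t = β + n + 1`, the ratio `(1 + a λ₂) / (1 + a λ₁) = 1 - a gap / (1
+ a λ₁)` is at most `exp (-a gap + a² λ₁²)`. Since `a gap = 6 / t` and `exp (-1 / t) ≤ t / (t + 1)`,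
squaring gives the twelfth power. -/
lemma one_add_stepSize_mul_sq_add_le (hgap : 0 < gap) (hβ : 0 < β) (hlam2 : 0 ≤ lam2)
    (hlam : lam1 = lam2 + gap) (hV : 0 ≤ V) (n : ℕ) :
    (1 + stepSize gap β (n + 1) * lam2) ^ 2 + stepSize gap β (n + 1) ^ 2 * V ≤
      (1 + stepSize gap β (n + 1) * lam1) ^ 2 * ((β + n + 1) / (β + n + 2)) ^ 12 *
        Real.exp (2 * (stepSize gap β (n + 1) ^ 2 * (V + lam1 ^ 2))) := by
  have ha := stepSize_nonneg hgap hβ (n + 1)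
  have hag : stepSize gap β (n + 1) * gap = 6 * (1 / (β + n + 1)) := by
    rw [stepSize]
    push_cast
    have : β + (n + 1) ≠ 0 := by positivity
    field_simp
    ring
  set a := stepSize gap β (n + 1)
  set t := β + n + 1 with ht
  have ht0 : 0 < t := by positivity
  have hl1 : 0 ≤ lam1 := by linarith
  have hden : 0 < 1 + a * lam1 := by positivity
  have hexp : Real.exp (-(1 / t)) ≤ t / (t + 1) := by
    rw [Real.exp_neg, inv_le_comm₀ (Real.exp_pos _) (by positivity), inv_div]
    calc (t + 1) / t = 1 / t + 1 := by rw [add_div, div_self ht0.ne', add_comm]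
      _ ≤ _ := Real.add_one_le_exp _
  have h1 : 1 + a * lam2 ≤ (1 + a * lam1) * ((t / (t + 1)) ^ 6 * Real.exp (a ^ 2 * lam1 ^ 2)) := by
    have h2 : 1 + a * lam2 = (1 + a * lam1) * (1 - a * gap / (1 + a * lam1)) := by
      field_simp
      rw [hlam]
      ring
    have h3 : a * gap - a ^ 2 * lam1 ^ 2 ≤ a * gap / (1 + a * lam1) := by
      rw [le_div_iff₀ hden]
      have h31 : a ^ 2 * lam1 * gap ≤ a ^ 2 * lam1 * lam1 := by
        gcongr
        linarith
      have h32 : 0 ≤ a ^ 3 * lam1 ^ 3 := by positivity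
      nlinarith
    rw [h2]
    gcongr
    calc 1 - a * gap / (1 + a * lam1) ≤ Real.exp (-(a * gap / (1 + a * lam1))) := by
          linarith [Real.add_one_le_exp (-(a * gap / (1 + a * lam1)))]
      _ ≤ Real.exp (6 * -(1 / t) + a ^ 2 * lam1 ^ 2) := Real.exp_le_exp.2 (by linarith)
      _ = Real.exp (-(1 / t)) ^ 6 * Real.exp (a ^ 2 * lam1 ^ 2) := by
          rw [Real.exp_add, ← Real.exp_nat_mul]
          norm_num
      _ ≤ _ := by gcongr
  have h4 : (1 + a * lam2) ^ 2 + a ^ 2 * V ≤ (1 + a * lam2) ^ 2 * Real.exp (a ^ 2 * V) := by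
    have h5 : 1 ≤ (1 + a * lam2) ^ 2 := one_le_pow₀ (by linarith [mul_nonneg ha hlam2])
    have h6 : 0 ≤ a ^ 2 * V := by positivity
    have h7 := Real.add_one_le_exp (a ^ 2 * V)
    nlinarith
  have h8 : β + n + 2 = t + 1 := by
    rw [ht]
    ring
  rw [h8]
  calc _ ≤ (1 + a * lam2) ^ 2 * Real.exp (a ^ 2 * V) := h4
    _ ≤ ((1 + a * lam1) * ((t / (t + 1)) ^ 6 * Real.exp (a ^ 2 * lam1 ^ 2))) ^ 2 *
          Real.exp (a ^ 2 * V) := by gcongr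
    _ = (1 + a * lam1) ^ 2 * (t / (t + 1)) ^ 12 *
          Real.exp (2 * (a ^ 2 * lam1 ^ 2) + a ^ 2 * V) := by
        rw [Real.exp_add, two_mul, Real.exp_add]
        ring
    _ ≤ _ := by
        gcongr
        have : 0 ≤ a ^ 2 * V := by positivity
        linarith

/-- The weight `(β + n + 1)^12` is an integrating factor absorbing the contraction. Each noise
increment, of size `η² V` times the weight, then grows like the tenth power, and `n` of them are
bounded by the largest. -/
lemma perpBound_mul_le (hgap : 0 < gap) (hβ : 2 ≤ β) (hlam2 : 0 ≤ lam2)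
    (hlam : lam1 = lam2 + gap) (hV : 0 ≤ V) {d : ℕ} (hd : 0 < d) (n : ℕ) :
    d * perpBound (stepSize gap β) lam1 lam2 V d n * (β + n + 1) ^ 12 ≤
      topGrowth (stepSize gap β) lam1 n ^ 2 *
        Real.exp (2 * (36 * ((V + lam1 ^ 2) / gap ^ 2) * (1 / β - 1 / (β + n)))) *
        (d * (β + 1) ^ 12 + 72 * (V / gap ^ 2) * n * (β + n + 1) ^ 10) := by
  have hβ0 : 0 < β := by linarith
  have hl1 : 0 ≤ lam1 := by linarith
  have hd' : (0 : ℝ) < d := by exact_mod_cast hd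
  induction n with
  | zero => simp [perpBound, topGrowth]
  | succ n ih =>
    have hratio := one_add_stepSize_mul_sq_add_le hgap hβ0 hlam2 hlam hV n
    have hδ := stepSize_succ_sq_mul_le hgap hβ0 n (c := V + lam1 ^ 2) (by positivity)
    have hsq := sqGrowth_le hgap hβ0 hl1 hV n
    have hb0 := sqGrowth_nonneg (η := stepSize gap β) hV lam1 n
    have hx0 := perpBound_nonneg (η := stepSize gap β) hV lam1 lam2 d n
    have haV := stepSize_succ_sq_mul hgap hβ0 n V
    have ha := stepSize_nonneg hgap hβ0 (n + 1)
    rw [perpBound, topGrowth_succ]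
    set a := stepSize gap β (n + 1)
    set K := 36 * ((V + lam1 ^ 2) / gap ^ 2)
    have hK : 0 ≤ K := by positivity
    set E := K * (1 / β - 1 / (β + n)) with hE
    set E' := K * (1 / β - 1 / (β + (n + 1 : ℕ))) with hE'
    set G := topGrowth (stepSize gap β) lam1 n ^ 2 with hG
    set b := sqGrowth (stepSize gap β) lam1 V n
    set x := perpBound (stepSize gap β) lam1 lam2 V d n
    set W := V / gap ^ 2
    have hW : 0 ≤ W := by positivity
    have hE0 : 0 ≤ E := by
      refine mul_nonneg hK (sub_nonneg.2 ?_)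
      gcongr
      simp
    have hEE : E ≤ E' := by
      have : 0 ≤ a ^ 2 * (V + lam1 ^ 2) := by positivity
      linarith
    set t := β + n + 1 with ht
    have ht3 : 3 ≤ t := by
      have : (0 : ℝ) ≤ n := Nat.cast_nonneg n
      linarith
    have ht0 : 0 < t := by linarith
    have e1 : β + ((n + 1 : ℕ) : ℝ) + 1 = t + 1 := by
      push_cast
      ring
    have e2 : β + n + 2 = t + 1 := by
      rw [ht]
      ring
    rw [e2] at hratio
    rw [e1]
    have hG0 : 0 ≤ G := sq_nonneg _
    have hδ' : a ^ 2 * (V + lam1 ^ 2) ≤ E' - E := hδ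
    rw [mul_pow, ← hG]
    clear_value a E E' G b x W t
    have h1 : ((1 + a * lam2) ^ 2 + a ^ 2 * V) * (d * x) * (t + 1) ^ 12 ≤
        G * (1 + a * lam1) ^ 2 * Real.exp (2 * E') *
          (d * (β + 1) ^ 12 + 72 * W * n * (t + 1) ^ 10) := by
      calc _ ≤ (1 + a * lam1) ^ 2 * (t / (t + 1)) ^ 12 *
              Real.exp (2 * (a ^ 2 * (V + lam1 ^ 2))) * (d * x) * (t + 1) ^ 12 := by gcongr
        _ = (1 + a * lam1) ^ 2 * Real.exp (2 * (a ^ 2 * (V + lam1 ^ 2))) * (d * x * t ^ 12) := by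
            rw [div_pow]
            field_simp
        _ ≤ (1 + a * lam1) ^ 2 * Real.exp (2 * (E' - E)) *
              (G * Real.exp (2 * E) * (d * (β + 1) ^ 12 + 72 * W * n * t ^ 10)) := by
            refine mul_le_mul ?_ ih (by positivity) (by positivity)
            gcongr
        _ = G * (1 + a * lam1) ^ 2 * (Real.exp (2 * (E' - E)) * Real.exp (2 * E)) *
              (d * (β + 1) ^ 12 + 72 * W * n * t ^ 10) := by ring
        _ = G * (1 + a * lam1) ^ 2 * Real.exp (2 * E') *
              (d * (β + 1) ^ 12 + 72 * W * n * t ^ 10) := by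
            rw [← Real.exp_add]
            congr 3
            ring
        _ ≤ _ := by
            gcongr
            linarith
    have h2 : a ^ 2 * V * b * (t + 1) ^ 12 ≤
        G * (1 + a * lam1) ^ 2 * Real.exp (2 * E') * (72 * W * (t + 1) ^ 10) := by
      -- The loss of a factor 2 is `(t + 1)² ≤ 2 t²`, valid for `t ≥ 3`; this is why `β ≥ 2` is
      -- required.
      have h3 : 36 * W / t ^ 2 * (t + 1) ^ 2 ≤ 72 * W := by
        rw [div_mul_eq_mul_div, div_le_iff₀ (by positivity)]
        have h31 := mul_nonneg ht0.le (sub_nonneg.2 ht3)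
        have h32 : (t + 1) ^ 2 ≤ 2 * t ^ 2 := by linarith
        linarith [mul_le_mul_of_nonneg_left h32 hW]
      have h4 : b ≤ G * (1 + a * lam1) ^ 2 * Real.exp (2 * E') := by
        refine hsq.trans ?_
        have h5 : 1 ≤ (1 + a * lam1) ^ 2 := 
          one_le_pow₀ (by linarith [mul_nonneg ha hl1])
        calc G * Real.exp E ≤ G * 1 * Real.exp (2 * E') := by
              rw [mul_one]
              gcongr
              linarith
          _ ≤ _ := by gcongr
      calc _ = b * (36 * W / t ^ 2 * (t + 1) ^ 2) * (t + 1) ^ 10 := by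
            rw [haV]
            ring
        _ ≤ (G * (1 + a * lam1) ^ 2 * Real.exp (2 * E')) * (72 * W) * (t + 1) ^ 10 := by gcongr
        _ = _ := by ring
    calc _ = ((1 + a * lam2) ^ 2 + a ^ 2 * V) * (d * x) * (t + 1) ^ 12 +
          a ^ 2 * V * b * (t + 1) ^ 12 := by
          field_simp
      _ ≤ _ := add_le_add h1 h2
      _ = _ := by
          push_cast
          ring

lemma perpBound_le (hgap : 0 < gap) (hβ : 2 ≤ β) (hlam2 : 0 ≤ lam2) (hlam : lam1 = lam2 + gap)
    (hV : 0 ≤ V) (hβ' : 720 * ((V + lam1 ^ 2) / gap ^ 2) ≤ β) {d n : ℕ} (hd : 0 < d) (hn : 0 < n)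
    (hnd : β ^ 12 * d ≤ (n : ℝ) ^ 10) :
    d * perpBound (stepSize gap β) lam1 lam2 V d n ≤ topGrowth (stepSize gap β) lam1 n ^ 2 *
      (5000 * (V / gap ^ 2 * (1 / n) + 1 / (n : ℝ) ^ 2)) := by
  have hβ0 : 0 < β := by linarith
  have hn' : (0 : ℝ) < n := by exact_mod_cast hn
  have h := perpBound_mul_le hgap hβ hlam2 hlam hV hd n
  set W := V / gap ^ 2
  have hW : 0 ≤ W := by positivity
  set G := topGrowth (stepSize gap β) lam1 n ^ 2
  have hG : 0 ≤ G := sq_nonneg _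
  -- As `720 = 36 · 20`, the telescoped sum is at most `1 / 20`, so the exponent is at most `1 /
  -- 10`.
  have hexp : Real.exp (2 * (36 * ((V + lam1 ^ 2) / gap ^ 2) * (1 / β - 1 / (β + n)))) ≤ 10 / 9 := by
    have h1 : 36 * ((V + lam1 ^ 2) / gap ^ 2) * (1 / β - 1 / (β + n)) ≤ β / 20 * (1 / β) := by
      have : 0 < 1 / (β + n) := by positivity
      have : 0 ≤ (V + lam1 ^ 2) / gap ^ 2 := by positivity
      calc _ ≤ 36 * ((V + lam1 ^ 2) / gap ^ 2) * (1 / β) := by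
            gcongr
            linarith
        _ ≤ _ := by
            gcongr
            linarith
    have h2 : β / 20 * (1 / β) = 1 / 20 := by field_simp
    calc _ ≤ Real.exp (1 / 10) := Real.exp_le_exp.2 (by linarith)
      _ ≤ 1 / (1 - 1 / 10) := Real.exp_bound_div_one_sub_of_interval (by norm_num) (by norm_num)
      _ = 10 / 9 := by norm_num
  have ht : 0 < β + n + 1 := by positivity
  -- Here `4096 = 2^12` comes from `β + 1 ≤ 2 β`, and `β^12 d ≤ n^10` leaves `1 / n²`; finally `4096
  -- · 10 / 9 < 5000`.
  have h1 : d * (β + 1) ^ 12 / (β + n + 1) ^ 12 ≤ 4096 * (1 / (n : ℝ) ^ 2) := by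
    calc _ ≤ d * (2 * β) ^ 12 / (n : ℝ) ^ 12 := by
          gcongr <;> linarith
      _ = 4096 * (β ^ 12 * d) / (n : ℝ) ^ 12 := by ring
      _ ≤ 4096 * (n : ℝ) ^ 10 / (n : ℝ) ^ 12 := by gcongr
      _ = _ := by field_simp
  have h2 : 72 * W * n * (β + n + 1) ^ 10 / (β + n + 1) ^ 12 ≤ 72 * (W * (1 / n)) := by
    calc _ = 72 * W * n / (β + n + 1) ^ 2 := by field_simp
      _ ≤ 72 * W * n / (n : ℝ) ^ 2 := by
          gcongr
          linarith
      _ = _ := by field_simp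
  have h3 : 0 ≤ W * (1 / (n : ℝ)) := by positivity
  have h4 : 0 ≤ 1 / (n : ℝ) ^ 2 := by positivity
  calc _ ≤ G * (10 / 9) * (d * (β + 1) ^ 12 + 72 * W * n * (β + n + 1) ^ 10) /
        (β + n + 1) ^ 12 := by
        rw [le_div_iff₀ (by positivity)]
        refine h.trans ?_
        gcongr
    _ = G * (10 / 9 * (d * (β + 1) ^ 12 / (β + n + 1) ^ 12 +
        72 * W * n * (β + n + 1) ^ 10 / (β + n + 1) ^ 12)) := by ring
    _ ≤ _ := mul_le_mul_of_nonneg_left (by linarith) hG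

lemma sqGrowth_sub_le (hgap : 0 < gap) (hβ : 0 < β) (hlam1 : 0 ≤ lam1)
    (hV : 0 ≤ V) (hβ' : 720 * ((V + lam1 ^ 2) / gap ^ 2) ≤ β) (n : ℕ) :
    sqGrowth (stepSize gap β) lam1 V n - topGrowth (stepSize gap β) lam1 n ^ 2 ≤
      1 / 16 * topGrowth (stepSize gap β) lam1 n ^ 2 := by
  have h := sqGrowth_le hgap hβ hlam1 hV n
  have hexp : Real.exp (36 * ((V + lam1 ^ 2) / gap ^ 2) * (1 / β - 1 / (β + n))) ≤ 20 / 19 := by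
    have h1 : 36 * ((V + lam1 ^ 2) / gap ^ 2) * (1 / β - 1 / (β + n)) ≤ β / 20 * (1 / β) := by
      have : 0 < 1 / (β + n) := by positivity
      have : 0 ≤ (V + lam1 ^ 2) / gap ^ 2 := by positivity
      calc _ ≤ 36 * ((V + lam1 ^ 2) / gap ^ 2) * (1 / β) := by
            gcongr
            linarith
        _ ≤ _ := by
            gcongr
            linarith
    have h2 : β / 20 * (1 / β) = 1 / 20 := by field_simp
    calc _ ≤ Real.exp (1 / 20) := Real.exp_le_exp.2 (by linarith)
      _ ≤ 1 / (1 - 1 / 20) := Real.exp_bound_div_one_sub_of_interval (by norm_num) (by norm_num)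
      _ = 20 / 19 := by norm_num
  have hG : 0 ≤ topGrowth (stepSize gap β) lam1 n ^ 2 := sq_nonneg _
  nlinarith [mul_le_mul_of_nonneg_left hexp hG]

end StepSizes

/-! ### The failure events -/

section Final

variable {d : ℕ}

lemma topGrowth_pos {η : ℕ → ℝ} (hη : ∀ i, 0 ≤ η i) {lam1 : ℝ} (hlam : 0 ≤ lam1) (n : ℕ) :
    0 < topGrowth η lam1 n :=
  Finset.prod_pos fun i _ => by
    have := mul_nonneg (hη (i + 1)) hlam
    linarith

/-- Outside the failure events, the output of Oja's algorithm is close to the top direction. -/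
lemma isApprox_oja (hd : 0 < d) {η : ℕ → ℝ} {n : ℕ} {A : Fin n → Matrix (Fin d) (Fin d) ℝ}
    {e w : EuclideanSpace ℝ (Fin d)} (he : ‖e‖ = 1) (hw : ‖w‖ = 1) {m R ε : ℝ} (hm : 0 < m)
    (hε : 0 ≤ ε) (htop : (inner ℝ e (ojaRaw η e n A) - m) ^ 2 < 16 / 25 * m ^ 2)
    (hinit : ‖ojaAdj η n A e‖ / (64 * √d) ≤ |inner ℝ (ojaAdj η n A e) w|)
    (hperp : ‖perp e (ojaRaw η w n A)‖ ^ 2 < 16 * R) (hR : 1638400 * (d * R) ≤ m ^ 2 * ε) :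
    IsApprox ε (oja η w n A) e := by
  have hd' : (0 : ℝ) < d := by exact_mod_cast hd
  set q := ojaAdj η n A e with hq
  set u := ojaRaw η w n A with hu
  have hZ : m / 5 < inner ℝ e (ojaRaw η e n A) := by
    have h1 : (inner ℝ e (ojaRaw η e n A) - m) ^ 2 < (4 / 5 * m) ^ 2 := by
      refine htop.trans_eq ?_
      ring
    have := (abs_lt_of_sq_lt_sq' h1 (by positivity)).1
    linarith
  have hqn : m / 5 ≤ ‖q‖ := by
    rw [inner_ojaRaw] at hZ
    have := real_inner_le_norm q e
    rw [he, mul_one] at this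
    linarith
  have hD : inner ℝ e u = inner ℝ q w := inner_ojaRaw η w n A e
  -- The constant is `(5 · 64)²`; multiplied by the Markov factor `16` it becomes the `1638400` of
  -- `hR`.
  have hDsq : m ^ 2 ≤ 102400 * d * inner ℝ e u ^ 2 := by
    have h1 : m / 5 / (64 * √d) ≤ |inner ℝ e u| := by
      rw [hD]
      exact le_trans (by gcongr) hinit
    have h2 : (m / 5 / (64 * √d)) ^ 2 ≤ inner ℝ e u ^ 2 := by
      rw [← sq_abs (inner ℝ e u)]
      gcongr
    have h3 : (m / 5 / (64 * √d)) ^ 2 = m ^ 2 / (102400 * d) := by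
      rw [div_pow, mul_pow, Real.sq_sqrt hd'.le]
      field_simp
      norm_num
    rwa [h3, div_le_iff₀' (by positivity)] at h2
  have hDpos : 0 < inner ℝ e u ^ 2 := by
    by_contra! h
    have h1 : 102400 * (d : ℝ) * inner ℝ e u ^ 2 ≤ 0 :=
      mul_nonpos_of_nonneg_of_nonpos (by positivity) h
    have h2 : 0 < m ^ 2 := by positivity
    linarith
  have hu0 : u ≠ 0 := by
    intro h
    simp [h] at hDpos
  have hupos : 0 < ‖u‖ := norm_pos_iff.2 hu0
  have hnp := norm_perp_sq he u
  rw [IsApprox, sinSq, oja_eq_of_ojaRaw_ne_zero η hw n A hu0]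
  refine ⟨by rw [norm_smul, norm_inv, norm_norm, inv_mul_cancel₀ hupos.ne'], ?_⟩
  have hsin : 1 - inner ℝ (‖u‖⁻¹ • u) e ^ 2 = ‖perp e u‖ ^ 2 / ‖u‖ ^ 2 := by
    rw [hnp, real_inner_smul_left, real_inner_comm]
    field_simp
  rw [hsin, div_le_iff₀ (by positivity)]
  have hDu : inner ℝ e u ^ 2 ≤ ‖u‖ ^ 2 := by linarith [sq_nonneg ‖perp e u‖]
  have h1 : 16 * R ≤ ε * inner ℝ e u ^ 2 := by
    have h2 : 102400 * d * (16 * R) ≤ 102400 * d * (ε * inner ℝ e u ^ 2) := by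
      linarith [mul_le_mul_of_nonneg_right hDsq hε]
    exact le_of_mul_le_mul_left h2 (by positivity)
  linarith [mul_le_mul_of_nonneg_left hDu hε]

variable {Ω : Type*} [MeasurableSpace Ω] {P : Measure Ω}

lemma measure_ofReal_le_le {f : Ω → ℝ} (hf : Measurable f) {a r : ℝ} (hr : 0 < r)
    (h : ∫⁻ ω, ENNReal.ofReal (f ω) ∂P ≤ ENNReal.ofReal a) :
    P {ω | r ≤ f ω} ≤ ENNReal.ofReal (a / r) := by
  have hr' : ENNReal.ofReal r ≠ 0 := (ENNReal.ofReal_pos.2 hr).ne'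
  calc P {ω | r ≤ f ω} ≤ P {ω | ENNReal.ofReal r ≤ ENNReal.ofReal (f ω)} :=
        measure_mono fun ω hω => ENNReal.ofReal_le_ofReal hω
    _ ≤ (∫⁻ ω, ENNReal.ofReal (f ω) ∂P) / ENNReal.ofReal r :=
        meas_ge_le_lintegral_div hf.ennreal_ofReal.aemeasurable hr' ENNReal.ofReal_ne_top
    _ ≤ ENNReal.ofReal a / ENNReal.ofReal r := by gcongr
    _ = _ := (ENNReal.ofReal_div_of_pos hr).symm

/-- By independence `X` can be frozen, and the sphere estimate holds uniformly in the fixed vector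
`q x`. -/
lemma measure_abs_inner_lt_le [IsProbabilityMeasure P] (hd : 0 < d) {α : Type*} [MeasurableSpace α] {X : Ω → α}
    {w₀ : Ω → EuclideanSpace ℝ (Fin d)} (hX : Measurable X) (hw : Measurable w₀)
    (hlaw : P.map w₀ = uniformSphere d) (hind : IndepFun w₀ X P)
    {q : α → EuclideanSpace ℝ (Fin d)} (hq : Measurable q) :
    P {ω | |inner ℝ (q (X ω)) (w₀ ω)| < ‖q (X ω)‖ / (64 * √d)} ≤ 1 / 16 := by
  have hs : MeasurableSet {z : α × EuclideanSpace ℝ (Fin d) |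
      |inner ℝ (q z.1) z.2| < ‖q z.1‖ / (64 * √d)} := by
    have h1 : Measurable fun z : α × EuclideanSpace ℝ (Fin d) => |inner ℝ (q z.1) z.2| := by
      fun_prop
    have h2 : Measurable fun z : α × EuclideanSpace ℝ (Fin d) => ‖q z.1‖ / (64 * √d) := by
      fun_prop
    exact measurableSet_lt h1 h2
  have := Measure.isProbabilityMeasure_map (μ := P) hX.aemeasurable
  have := Measure.isProbabilityMeasure_map (μ := P) hw.aemeasurable
  have h1 : P {ω | |inner ℝ (q (X ω)) (w₀ ω)| < ‖q (X ω)‖ / (64 * √d)} =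
      (P.map fun ω => (X ω, w₀ ω)) {z | |inner ℝ (q z.1) z.2| < ‖q z.1‖ / (64 * √d)} :=
    (Measure.map_apply (hX.prodMk hw) hs).symm
  rw [h1, (indepFun_iff_map_prod_eq_prod_map_map hX.aemeasurable hw.aemeasurable).1 hind.symm,
    Measure.prod_apply hs]
  calc _ ≤ ∫⁻ _, 1 / 16 ∂(P.map X) := by
        refine lintegral_mono fun x => ?_
        rw [hlaw]
        exact uniformSphere_abs_inner_lt_le hd (q x)
    _ = _ := by simp

lemma pow_mul_le_of_rpow_mul_rpow_lt {β : ℝ} (hβ : 0 ≤ β) {n : ℕ}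
    (h : β ^ (1.2 : ℝ) * (d : ℝ) ^ (0.1 : ℝ) < n) : β ^ 12 * d ≤ (n : ℝ) ^ 10 := by
  have hd : (0 : ℝ) ≤ d := Nat.cast_nonneg d
  have h1 : (β ^ (1.2 : ℝ) * (d : ℝ) ^ (0.1 : ℝ)) ^ 10 = β ^ 12 * d := by
    rw [mul_pow, ← Real.rpow_mul_natCast hβ, ← Real.rpow_mul_natCast hd, ← Real.rpow_natCast β 12]
    norm_num
  rw [← h1]
  gcongr

/-- The failure budget: `25/256 + 1/16 + 1/16 = 57/256 < 1/4`, which makes the final inequality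
strict. -/
lemma three_quarters_lt_of_one_le_add {x : ℝ≥0∞}
    (h : 1 ≤ x + 25 / 256 + 1 / 16 + 1 / 16 + 0) : 3 / 4 < x := by
  by_contra! hlt
  have hle : (1 : ℝ≥0∞) ≤ 3 / 4 + 25 / 256 + 1 / 16 + 1 / 16 + 0 := h.trans (by gcongr)
  rw [← ENNReal.toReal_le_toReal (by finiteness) (by finiteness), ENNReal.toReal_add (by finiteness)
    (by finiteness), ENNReal.toReal_add (by finiteness) (by finiteness),
    ENNReal.toReal_add (by finiteness) (by finiteness),
    ENNReal.toReal_add (by finiteness) (by finiteness)] at hle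
  norm_num at hle

lemma Model.measure_top_deviation_le [IsProbabilityMeasure P] {n : ℕ}
    {A : Fin n → Ω → Matrix (Fin d) (Fin d) ℝ} {S : Matrix (Fin d) (Fin d) ℝ} {M V : ℝ}
    (h : Model P A S M V) {v : OrthonormalBasis (Fin d) ℝ (EuclideanSpace ℝ (Fin d))}
    {lam : Fin d → ℝ} (hv : IsEigenDecomp S v lam) {i₀ i₁ : Fin d}
    (hi : IsTopPair lam i₀ i₁) {η : ℕ → ℝ} (hη : ∀ i, 0 ≤ η i)
    (hV : 0 ≤ V) (hpos : 0 < topGrowth η (lam i₀) n)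
    (hvar : sqGrowth η (lam i₀) V n - topGrowth η (lam i₀) n ^ 2 ≤
      1 / 16 * topGrowth η (lam i₀) n ^ 2) :
    P {ω | 16 / 25 * topGrowth η (lam i₀) n ^ 2 ≤
      (inner ℝ (v i₀) (ojaRaw η (v i₀) n fun i => A i ω) -
        topGrowth η (lam i₀) n) ^ 2} ≤ 25 / 256 := by
  have hint := (h.lintegral_inner_ojaRaw_sub_sq_le hv hi hη hV).trans
    (ENNReal.ofReal_le_ofReal hvar)
  have hmeas : Measurable fun ω => ojaRaw η (v i₀) n fun i => A i ω :=
    (continuous_ojaRaw η n).measurable.comp (measurable_const.prodMk h.measurable_pi)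
  generalize topGrowth η (lam i₀) n = m at *
  have hf : Measurable fun ω => (inner ℝ (v i₀)
      (ojaRaw η (v i₀) n fun i => A i ω) - m) ^ 2 := by
    fun_prop
  have hr : 0 < 16 / 25 * m ^ 2 := by positivity
  refine (measure_ofReal_le_le hf hr hint).trans (le_of_eq ?_)
  -- Chebyshev with relative variance `1 / 16` and relative deviation `4 / 5`.
  have : 1 / 16 * m ^ 2 / (16 / 25 * m ^ 2) = 25 / 256 := by
    field_simp
    norm_num
  rw [this, ENNReal.ofReal_div_of_pos (by norm_num), ENNReal.ofReal_ofNat, ENNReal.ofReal_ofNat]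

lemma Model.measure_perp_ge_le [IsProbabilityMeasure P] {n : ℕ}
    {A : Fin n → Ω → Matrix (Fin d) (Fin d) ℝ} {S : Matrix (Fin d) (Fin d) ℝ} {M V : ℝ}
    (h : Model P A S M V) {v : OrthonormalBasis (Fin d) ℝ (EuclideanSpace ℝ (Fin d))}
    {lam : Fin d → ℝ} (hv : IsEigenDecomp S v lam) {i₀ i₁ : Fin d}
    (hi : IsTopPair lam i₀ i₁) {η : ℕ → ℝ} (hη : ∀ i, 0 ≤ η i)
    (hV : 0 ≤ V) {w₀ : Ω → EuclideanSpace ℝ (Fin d)} (hw : Measurable w₀)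
    (hlaw : P.map w₀ = uniformSphere d) (hind : IndepFun w₀ (fun ω i => A i ω) P) {R : ℝ}
    (hR0 : 0 < R) (hR : perpBound η (lam i₀) (lam i₁) V d n ≤ R) :
    P {ω | 16 * R ≤ ‖perp (v i₀) (ojaRaw η (w₀ ω) n fun i => A i ω)‖ ^ 2} ≤
      1 / 16 := by
  have hper := (h.lintegral_uniformSphere_perp_le hv hi hη hV).trans (ENNReal.ofReal_le_ofReal hR)
  generalize v i₀ = e at *
  have hA := h.measurable_pi
  have hraw : Measurable fun z : EuclideanSpace ℝ (Fin d) × (Fin n → Matrix (Fin d) (Fin d) ℝ) =>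
      ojaRaw η z.1 n z.2 := (continuous_ojaRaw η n).measurable
  have hmeas : Measurable fun ω => ojaRaw η (w₀ ω) n fun i => A i ω := hraw.comp (hw.prodMk hA)
  have hf : Measurable fun z : EuclideanSpace ℝ (Fin d) ×
      (Fin n → Matrix (Fin d) (Fin d) ℝ) => ENNReal.ofReal (‖perp e (ojaRaw η z.1 n z.2)‖ ^ 2) := by
    fun_prop
  have hf' : Measurable fun ω => ‖perp e (ojaRaw η (w₀ ω) n fun i => A i ω)‖ ^ 2 := by fun_prop
  have hraw' : Measurable fun z : EuclideanSpace ℝ (Fin d) × Ω =>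
      ojaRaw η z.1 n fun i => A i z.2 :=
    hraw.comp (measurable_fst.prodMk (hA.comp measurable_snd))
  have hg : Measurable fun z : EuclideanSpace ℝ (Fin d) × Ω =>
      ENNReal.ofReal (‖perp e (ojaRaw η z.1 n fun i => A i z.2)‖ ^ 2) := by
    fun_prop
  have hint : ∫⁻ ω, ENNReal.ofReal (‖perp e (ojaRaw η (w₀ ω) n fun i => A i ω)‖ ^ 2) ∂P ≤
      ENNReal.ofReal R := by
    calc _ = ∫⁻ ω, ∫⁻ ω', ENNReal.ofReal
            (‖perp e (ojaRaw η (w₀ ω) n fun i => A i ω')‖ ^ 2) ∂P ∂P :=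
          lintegral_indepFun hw hA hind hf
      _ = _ := (lintegral_map hg.lintegral_prod_right' hw).symm
      _ ≤ _ := by rwa [hlaw]
  refine (measure_ofReal_le_le hf' (by positivity : 0 < 16 * R) hint).trans (le_of_eq ?_)
  have : R / (16 * R) = 1 / 16 := by field_simp
  rw [this, ENNReal.ofReal_div_of_pos (by norm_num), ENNReal.ofReal_one, ENNReal.ofReal_ofNat]

lemma lt_measure_isApprox_oja [IsProbabilityMeasure P] {n : ℕ} {i₀ i₁ : Fin d} (hn : 1 ≤ n)
    {A : Fin n → Ω → Matrix (Fin d) (Fin d) ℝ} {S : Matrix (Fin d) (Fin d) ℝ} {M V gap β : ℝ}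
    {v : OrthonormalBasis (Fin d) ℝ (EuclideanSpace ℝ (Fin d))} {lam : Fin d → ℝ}
    {w₀ : Ω → EuclideanSpace ℝ (Fin d)} (h : Model P A S M V) (hv : IsEigenDecomp S v lam)
    (hi : IsTopPair lam i₀ i₁) (hw : Measurable w₀) (hlaw : P.map w₀ = uniformSphere d)
    (hind : IndepFun w₀ (fun ω i => A i ω) P)
    (hlam : lam i₀ = lam i₁ + gap) (hgap : 0 < gap) (hβ : 2 ≤ β)
    (hβ' : 720 * ((V + lam i₀ ^ 2) / gap ^ 2) ≤ β)
    (hnd : β ^ 12 * d ≤ (n : ℝ) ^ 10) :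
    3 / 4 < P {ω | IsApprox (8192000000 * (V / gap ^ 2 * (1 / (n : ℝ)) + 1 / (n : ℝ) ^ 2))
      (oja (stepSize gap β) (w₀ ω) n (fun i => A i ω)) (v i₀)} := by
  have hd0 : 0 < d := i₀.pos
  have hd' : (0 : ℝ) < d := by exact_mod_cast hd0
  have hβ0 : 0 < β := by linarith
  have hV : 0 ≤ V := h.variance_nonneg ⟨0, hn⟩
  have hη := stepSize_nonneg hgap hβ0
  have hl2 := hv.eigenvalue_nonneg h.posSemidef i₁
  have hl1 := hv.eigenvalue_nonneg h.posSemidef i₀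
  have hvar' := sqGrowth_sub_le hgap hβ0 hl1 hV hβ' n
  have hper' := perpBound_le hgap hβ hl2 hlam hV hβ' hd0 hn hnd
  have hmpos := topGrowth_pos hη hl1 n
  set e := v i₀ with he
  set η := stepSize gap β
  set m := topGrowth η (lam i₀) n
  set ε := V / gap ^ 2 * (1 / (n : ℝ)) + 1 / (n : ℝ) ^ 2 with hε
  have he1 : ‖e‖ = 1 := v.orthonormal.1 _
  have hε0 : 0 < ε := by
    have hn' : (0 : ℝ) < n := by exact_mod_cast hn
    positivity
  set R := m ^ 2 * (5000 * ε) / d with hR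
  have hR0 : 0 < R := by positivity
  have hdR : d * R = m ^ 2 * (5000 * ε) := by
    rw [hR]
    field_simp
  have hperR : perpBound η (lam i₀) (lam i₁) V d n ≤ R := by
    rw [hR, le_div_iff₀' hd']
    exact hper'
  have hA := h.measurable_pi
  have hbad1 := h.measure_top_deviation_le hv hi hη hV hmpos hvar'
  have hq : Measurable fun a : Fin n → Matrix (Fin d) (Fin d) ℝ => ojaAdj η n a e :=
    (continuous_ojaAdj η n).measurable.comp (measurable_id.prodMk measurable_const)
  have hbad2 : P {ω | |inner ℝ (ojaAdj η n (fun i => A i ω) e) (w₀ ω)| <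
      ‖ojaAdj η n (fun i => A i ω) e‖ / (64 * √d)} ≤ 1 / 16 :=
    measure_abs_inner_lt_le (X := fun ω i => A i ω) (q := fun a => ojaAdj η n a e) hd0 hA hw hlaw
      hind hq
  have hbad3 := h.measure_perp_ge_le hv hi hη hV hw hlaw hind hR0 hperR
  have hbad4 : P {ω | ¬‖w₀ ω‖ = 1} = 0 := by
    have h1 := ae_uniformSphere_norm (d := d)
    rw [← hlaw] at h1
    exact ae_of_ae_map hw.aemeasurable h1
  set good := {ω | IsApprox (8192000000 * ε) (oja η (w₀ ω) n (fun i => A i ω)) e}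
  -- Covering the whole space uses only subadditivity, so measurability of `good` is not needed.
  have hcover : Set.univ ⊆ good ∪
      {ω | 16 / 25 * m ^ 2 ≤ (inner ℝ e (ojaRaw η e n fun i => A i ω) - m) ^ 2} ∪
      {ω | |inner ℝ (ojaAdj η n (fun i => A i ω) e) (w₀ ω)| <
        ‖ojaAdj η n (fun i => A i ω) e‖ / (64 * √d)} ∪
      {ω | 16 * R ≤ ‖perp e (ojaRaw η (w₀ ω) n fun i => A i ω)‖ ^ 2} ∪ {ω | ¬‖w₀ ω‖ = 1} := by
    intro ω _
    by_contra hω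
    simp only [Set.mem_union, Set.mem_ofPred_eq, not_or, not_le, not_lt, not_not] at hω
    obtain ⟨⟨⟨⟨hg, h1⟩, h2⟩, h3⟩, h4⟩ := hω
    refine hg (isApprox_oja hd0 he1 h4 hmpos (by positivity) h1 h2 h3 ?_)
    rw [hdR]
    linarith
  have hsum : 1 ≤ P good + 25 / 256 + 1 / 16 + 1 / 16 + 0 := by
    calc 1 = P Set.univ := measure_univ.symm
      _ ≤ _ := measure_mono hcover
      _ ≤ _ := (measure_union_le _ _).trans (add_le_add ((measure_union_le _ _).trans (add_le_add
          ((measure_union_le _ _).trans (add_le_add ((measure_union_le _ _).trans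
            (add_le_add le_rfl hbad1)) hbad2)) hbad3)) hbad4.le)
  exact three_quarters_lt_of_one_le_add hsum

end Final

end StreamingPCA

/-! ### The main theorem -/

theorem theorem1p4 :
    ∃ C : ℝ, 0 < C ∧
      ∀ {Ω : Type*} [MeasurableSpace Ω] (P : Measure Ω) [IsProbabilityMeasure P]
        (d n : ℕ) (hd : 2 ≤ d) (hn : 1 ≤ n)
        (A : Fin n → Ω → Matrix (Fin d) (Fin d) ℝ) (S : Matrix (Fin d) (Fin d) ℝ) (M V : ℝ)
        (v : OrthonormalBasis (Fin d) ℝ (EuclideanSpace ℝ (Fin d))) (lam : Fin d → ℝ)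
        (w₀ : Ω → EuclideanSpace ℝ (Fin d)) (v1 : EuclideanSpace ℝ (Fin d))
        (lam1 gap β : ℝ),
        StreamingPCA.Model P A S M V →
        StreamingPCA.IsEigenDecomp S v lam →
        Measurable w₀ →
        P.map w₀ = StreamingPCA.uniformSphere d →
        IndepFun w₀ (fun ω i => A i ω) P →
        v1 = v ⟨0, by omega⟩ →
        lam1 = lam ⟨0, by omega⟩ →
        gap = lam ⟨0, by omega⟩ - lam ⟨1, by omega⟩ →
        0 < gap →
        β = StreamingPCA.stepOffset M V lam1 gap →
        β ^ (1.2 : ℝ) * (d : ℝ) ^ (0.1 : ℝ) < (n : ℝ) →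
        3 / 4 < P {ω | StreamingPCA.IsApprox (C * (V / gap ^ 2 * (1 / (n : ℝ)) + 1 / (n : ℝ) ^ 2))
          (StreamingPCA.oja (StreamingPCA.stepSize gap β) (w₀ ω) n (fun i => A i ω)) v1} := by
  -- The constant is `5000 · 1638400`: the numerator bound times the loss in the denominator and in
  -- Markov's inequality.
  refine ⟨8192000000, by norm_num, ?_⟩
  intro Ω _ P _ d n hd hn A S M V v lam w₀ v1 lam1 gap β h hv hw hlaw hind hv1 hlam1 hgap hgap0 hβ
    hnd
  subst hv1 hlam1
  have hi : StreamingPCA.IsTopPair lam ⟨0, by omega⟩ ⟨1, by omega⟩ := by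
    refine ⟨fun i => hv.antitone (Fin.mk_le_of_le_val (Nat.zero_le _)), fun i hne => ?_⟩
    refine hv.antitone (Fin.mk_le_of_le_val (Nat.one_le_iff_ne_zero.2 fun h0 => hne (Fin.ext h0)))
  have hV : 0 ≤ V := h.variance_nonneg ⟨0, hn⟩
  have hl2 := hv.eigenvalue_nonneg h.posSemidef ⟨1, by omega⟩
  have hlam : lam ⟨0, by omega⟩ = lam ⟨1, by omega⟩ + gap := by linarith
  have hβ' : 720 * ((V + lam ⟨0, by omega⟩ ^ 2) / gap ^ 2) ≤ β := by
    rw [hβ, StreamingPCA.stepOffset]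
    exact mul_le_mul_of_nonneg_left (le_max_right _ _) (by norm_num)
  -- Positive semidefiniteness gives `λ₂ ≥ 0`, so `λ₁ ≥ gap` and in fact `β ≥ 720`.
  have hβ2 : 2 ≤ β := by
    have h1 : 1 ≤ (V + lam ⟨0, by omega⟩ ^ 2) / gap ^ 2 := by
      rw [one_le_div (by positivity), hlam]
      nlinarith
    linarith
  exact StreamingPCA.lt_measure_isApprox_oja hn h hv hi hw hlaw hind hlam hgap0 hβ2 hβ'
    (StreamingPCA.pow_mul_le_of_rpow_mul_rpow_lt (by linarith) hnd)
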